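/- Let $N=\{1,\dots,n\}$, $n\ge 1$, be a set of agents and $G$ a finite set of $m$ goods. Let $c\ge 2$ be an integer, and let every agent $i$ have a $(1,c)$-bivalued submodular valuation $v_i:2^G\to\mathbb R$, i.e. $v_i(\emptyset)=0$, $v_i(S\cup\{g\})-v_i(S)\in\{1,c\}$ for all $S\subseteq G$ and $g\in G\setminus S$, and $v_i(S\cup\{g\})-v_i(S)\ge v_i(T\cup\{g\})-v_i(T)$ for all $S\subseteq T\subseteq G$ and $g\in G\setminus T$. (This is the case of $(a,b)$-bivalued submodular valuations, $0<a<b$ and $b=ca$, after dividing all valuations by $a$.) An allocation is a partition $X=(X_0,X_1,\dots,X_n)$ of $G$, where $X_i$ is the bundle of agent $i$ and $X_0$ consists of the unallocated goods. Let $P_X=\{i\in N: v_i(X_i)>0\}$. A max Nash welfare allocation is an allocation that maximizes $|P_X|$ and, subject to that, maximizes $\prod_{i\in P_X}v_i(X_i)$. For $M>0$ put $$\phi(X,i,d)=\begin{cases}\dfrac{v_i(X_i)+d}{v_i(X_i)} & \text{if } v_i(X_i)>0,\\ M d & \text{if } v_i(X_i)=0.\end{cases}$$ Let $v_0(S)=c|S|$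 and, for $i\in N\cup\{0\}$, $\beta_i(S)=\max\{|T|:T\subseteq S,\ v_i(T)=c|T|\}$. The exchange graph of an allocation $X$ is the directed graph on $G$ with an edge from $g$ to $g'$ if $g\in X_j$ and $\beta_j((X_j\setminus\{g\})\cup\{g'\})=\beta_j(X_j)$ for some $j\in N\cup\{0\}$; and $F_i(X)=\{g\in G:\beta_i(X_i\cup\{g\})=\beta_i(X_i)+1\}$. Bivalued Yankee Swap with the gain function $\phi$ maintains an allocation $X^c$, pairwise disjoint bundles $X^1_1,\dots,X^1_n\subseteq X^c_0$, and a set $U\subseteq N$. Initially $X^c_0=G$, all other bundles are empty, and $U=N$. Let $X=X^c\cup X^1$ be the allocation with $X_i=X^c_i\cup X^1_i$ for $i\in N$ and all other goods unallocated. While $\sum_{h\in N}|X^1_h|<|X^c_0|$, compare $\mathrm{Gain}_c=\max_{k\in U}\phi(X,k,c)$ and $\mathrm{Gain}_1=\max_{k\in N\setminus U}\phi(X,k,1)$, where a maximum over the empty set is $-\infty$. * If $\mathrm{Gain}_c\ge\mathrm{Gain}_1$, let $i$ be the agent of least index among those in $U$ attaining $\mathrm{Gain}_c$. If there is a path in the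 exchange graph of $X^c$ from $F_i(X^c)$ to $X^c_0$, take any shortest such path $(g_1,\dots,g_t)$; in $X^c$, give $g_1$ to $i$ and give each $g_{r+1}$ to the previous holder of $g_r$; if $g_t\in X^1_j$ for some $j\in N$, replace $g_t$ in $X^1_j$ by any good of $X^c_0\setminus\bigcup_h X^1_h$. If there is no such path, remove $i$ from $U$. * If $\mathrm{Gain}_c<\mathrm{Gain}_1$, let $i$ be the agent of least index among those in $N\setminus U$ attaining $\mathrm{Gain}_1$, and add to $X^1_i$ any good of $X^c_0\setminus\bigcup_h X^1_h$. When the loop ends, the output is $X^c\cup X^1$. **Theorem.** For every integer $c\ge 2$ there is a real number $M_0$, depending only on $c$, such that for every $M\ge M_0$, all $n\ge1$ and $m\ge 0$, and all $(1,c)$-bivalued submodular valuations $v_1,\dots,v_n$ on $m$ goods, Bivalued Yankee Swap with the gain function $\phi$ computes a max Nash welfare allocation: whatever choices are made where the algorithm leaves a choice, it never gets stuck, it stops after at most $n+m$ iterations, and its output is a max Nash welfare allocation. -/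

import Mathlib

/-!
# Fair allocation with bivalued submodular valuations: the Bivalued Yankee Swap algorithm

The agents are `Fin n` (ordered by their index), the goods form a finite type `G`.
-/

namespace YankeeSwap

variable {n : ℕ} {G : Type*}

/-- A set function `v` is an `(a, b)`-bivalued submodular valuation. -/
def IsBivaluedSubmodular [DecidableEq G] (a b : ℝ) (v : Finset G → ℝ) : Prop :=
  v ∅ = 0 ∧
  (∀ (S : Finset G) (g : G), g ∉ S → v (insert g S) - v S = a ∨ v (insert g S) - v S = b) ∧
  ∀ (S T : Finset G) (g : G), S ⊆ T → g ∉ T → v (insert g T) - v T ≤ v (insert g S) - v S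

/-- An allocation, given by the owner of each good. The value `none` stands for the dummy
agent `0`, who holds the unallocated goods, and `some i` for agent `i`. -/
abbrev Allocation (n : ℕ) (G : Type*) := G → Option (Fin n)

/-- The bundle `X_j` held by `j` (an agent, or the dummy agent `none`). -/
def bundle [Fintype G] (X : Allocation n G) (j : Option (Fin n)) : Finset G :=
  Finset.univ.filter fun g => X g = j

/-- The utility vector `(v_1(X_1), …, v_n(X_n))`. -/
def utility [Fintype G] (v : Fin n → Finset G → ℝ) (X : Allocation n G) : Fin n → ℝ :=
  fun i => v i (bundle X (some i))

/-! ### Nash welfare -/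

/-- The set `P_u` of agents with positive utility. -/
noncomputable def positiveAgents (u : Fin n → ℝ) : Finset (Fin n) :=
  Finset.univ.filter fun i => 0 < u i

/-- `u` is at least as good as `w` for Nash welfare: first compare the number of agents with
positive utility, then the product of the positive utilities. -/
def NashGE (u w : Fin n → ℝ) : Prop :=
  (positiveAgents w).card < (positiveAgents u).card ∨
  (positiveAgents u).card = (positiveAgents w).card ∧
    ∏ i ∈ positiveAgents w, w i ≤ ∏ i ∈ positiveAgents u, u i

/-- `X` is a max Nash welfare allocation. -/
def IsMaxNashWelfare [Fintype G] (v : Fin n → Finset G → ℝ) (X : Allocation n G) : Prop :=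
  ∀ Y : Allocation n G, NashGE (utility v X) (utility v Y)

/-- The gain function for Nash welfare, as a function of the utility vector `u`, an agent `i`
and an added value `d`. -/
noncomputable def phiMNW (M : ℝ) (u : Fin n → ℝ) (i : Fin n) (d : ℝ) : ℝ :=
  if 0 < u i then (u i + d) / u i else M * d

/-! ### The exchange graph -/

/-- The valuations of all agents, where the dummy agent has `v_0(S) = c |S|`. -/
def extValuation (c : ℝ) (v : Fin n → Finset G → ℝ) : Option (Fin n) → Finset G → ℝ
  | none => fun S => c * S.card
  | some i => v i

open Classical in
/-- `β(S) = max {|T| : T ⊆ S, w(T) = c |T|}` for a valuation `w`. -/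
noncomputable def beta (c : ℝ) (w : Finset G → ℝ) (S : Finset G) : ℕ :=
  (S.powerset.filter fun T => w T = c * T.card).sup Finset.card

/-- There is an edge from `g` to `g'` in the exchange graph of `X`: the holder `j` of `g`
satisfies `β_j(X_j - g + g') = β_j(X_j)`. -/
def ExchangeEdge [Fintype G] [DecidableEq G] (c : ℝ) (v : Fin n → Finset G → ℝ)
    (X : Allocation n G) (g g' : G) : Prop :=
  beta c (extValuation c v (X g)) (insert g' ((bundle X (X g)).erase g)) =
    beta c (extValuation c v (X g)) (bundle X (X g))

/-- The set `F_i(X)` of goods whose marginal gain for agent `i` under `β_i` is `1`. -/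
def highGainGoods [Fintype G] [DecidableEq G] (c : ℝ) (v : Fin n → Finset G → ℝ)
    (X : Allocation n G) (i : Fin n) : Set G :=
  {g | beta c (v i) (insert g (bundle X (some i))) = beta c (v i) (bundle X (some i)) + 1}

/-- The list of goods `p` is a path in the exchange graph of `X` from `F_i(X)` to `X_0`. -/
def IsTransferPath [Fintype G] [DecidableEq G] (c : ℝ) (v : Fin n → Finset G → ℝ)
    (X : Allocation n G) (i : Fin n) (p : List G) : Prop :=
  p.IsChain (ExchangeEdge c v X) ∧
  (∃ g ∈ p.head?, g ∈ highGainGoods c v X i) ∧ (∃ g ∈ p.getLast?, X g = none)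

/-- The path `p` is a shortest path from `F_i(X)` to `X_0`. -/
def IsShortestTransferPath [Fintype G] [DecidableEq G] (c : ℝ) (v : Fin n → Finset G → ℝ)
    (X : Allocation n G) (i : Fin n) (p : List G) : Prop :=
  IsTransferPath c v X i p ∧ ∀ q, IsTransferPath c v X i q → p.length ≤ q.length

/-- Path augmentation: the first good of the path is given to `a`, and every further good is
given to the agent who holds the good before it. -/
def augment [DecidableEq G] (X : Allocation n G) : Option (Fin n) → List G → Allocation n G
  | _, [] => X
  | a, g :: p => Function.update (augment X (X g) p) g a

/-! ### Bivalued Yankee Swap -/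

/-- The data maintained by the algorithm. -/
structure State (n : ℕ) (G : Type*) where
  /-- the allocation `X^c` of the high valued goods; its part `X^c_0` contains both the
  unallocated and the provisionally allocated goods -/
  high : Allocation n G
  /-- the provisional allocation `X^1`: the good `g` lies in `X^1_i` iff `low g = some i` -/
  low : Allocation n G
  /-- the set `U` of agents still in play for high valued goods -/
  inPlay : Finset (Fin n)

/-- Initially nothing is allocated and all agents are in play. -/
def State.init (n : ℕ) (G : Type*) : State n G where
  high := fun _ => none
  low := fun _ => none
  inPlay := Finset.univ

/-- The allocation `X^c ∪ X^1`. Throughout a run, `X^1_i ⊆ X^c_0` for every agent `i`. -/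
def State.union (s : State n G) : Allocation n G :=
  fun g => (s.high g).or (s.low g)

/-- The loop condition `∑_h |X^1_h| < |X^c_0|`. -/
def State.Running [Fintype G] (s : State n G) : Prop :=
  ∑ h : Fin n, (bundle s.low (some h)).card < (bundle s.high none).card

/-- The goods of `X^c_0 \ ⋃_h X^1_h`. -/
def State.IsFree (s : State n G) (g : G) : Prop :=
  s.high g = none ∧ s.low g = none

section Gain

variable [Fintype G] (v : Fin n → Finset G → ℝ) (φ : (Fin n → ℝ) → Fin n → ℝ → ℝ)

/-- The maximum of `φ(X^c ∪ X^1, k, d)` over `k ∈ A`, which is `-∞` (that is, `⊥`) if `A` is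
empty. -/
noncomputable def State.gain (s : State n G) (A : Finset (Fin n)) (d : ℝ) : WithBot ℝ :=
  A.sup fun k => ((φ (utility v s.union) k d : ℝ) : WithBot ℝ)

/-- `i` is the agent of least index in the argmax of `φ(X^c ∪ X^1, k, d)` over `k ∈ A`. -/
def State.Chooses (s : State n G) (A : Finset (Fin n)) (d : ℝ) (i : Fin n) : Prop :=
  IsLeast {j | j ∈ A ∧ ∀ k ∈ A, φ (utility v s.union) k d ≤ φ (utility v s.union) j d} i

end Gain

/-- One iteration of the main loop of Bivalued Yankee Swap with the gain function `φ`. All the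
choices that the algorithm leaves open (the shortest path, and the free goods) are
nondeterministic here. -/
inductive Step [Fintype G] [DecidableEq G] (c : ℝ) (v : Fin n → Finset G → ℝ)
    (φ : (Fin n → ℝ) → Fin n → ℝ → ℝ) : State n G → State n G → Prop
  /-- An agent in play receives a high valued good along a path which ends in a good that is
  not provisionally allocated. -/
  | transfer (s : State n G) (i : Fin n) (p : List G) (t : G)
      (running : s.Running)
      (gain : s.gain v φ s.inPlayᶜ 1 ≤ s.gain v φ s.inPlay c)
      (chosen : s.Chooses v φ s.inPlay c i)
      (path : IsShortestTransferPath c v s.high i p)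
      (last : t ∈ p.getLast?)
      (not_low : s.low t = none) :
      Step c v φ s ⟨augment s.high (some i) p, s.low, s.inPlay⟩
  /-- An agent in play receives a high valued good along a path which ends in a good
  provisionally allocated to `j`; this good is replaced with a free good. -/
  | steal (s : State n G) (i : Fin n) (p : List G) (t : G) (j : Fin n) (g : G)
      (running : s.Running)
      (gain : s.gain v φ s.inPlayᶜ 1 ≤ s.gain v φ s.inPlay c)
      (chosen : s.Chooses v φ s.inPlay c i)
      (path : IsShortestTransferPath c v s.high i p)
      (last : t ∈ p.getLast?)
      (low : s.low t = some j)
      (free : s.IsFree g) :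
      Step c v φ s ⟨augment s.high (some i) p,
        Function.update (Function.update s.low t none) g (some j), s.inPlay⟩
  /-- The chosen agent in play has no path to an unallocated good and leaves `U`. -/
  | leave (s : State n G) (i : Fin n)
      (running : s.Running)
      (gain : s.gain v φ s.inPlayᶜ 1 ≤ s.gain v φ s.inPlay c)
      (chosen : s.Chooses v φ s.inPlay c i)
      (no_path : ¬ ∃ p, IsTransferPath c v s.high i p) :
      Step c v φ s ⟨s.high, s.low, s.inPlay.erase i⟩
  /-- An agent no longer in play provisionally receives a free good. -/
  | provisional (s : State n G) (i : Fin n) (g : G)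
      (running : s.Running)
      (gain : s.gain v φ s.inPlay c < s.gain v φ s.inPlayᶜ 1)
      (chosen : s.Chooses v φ s.inPlayᶜ 1 i)
      (free : s.IsFree g) :
      Step c v φ s ⟨s.high, Function.update s.low g (some i), s.inPlay⟩

/-- `Reaches c v φ k s`: some run of the algorithm is in the state `s` after `k` iterations. -/
inductive Reaches [Fintype G] [DecidableEq G] (c : ℝ) (v : Fin n → Finset G → ℝ)
    (φ : (Fin n → ℝ) → Fin n → ℝ → ℝ) : ℕ → State n G → Prop
  | init : Reaches c v φ 0 (State.init n G)
  | step {k : ℕ} {s s' : State n G} :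
      Reaches c v φ k s → Step c v φ s s' → Reaches c v φ (k + 1) s'

end YankeeSwap

/-!
A `(1, c)`-bivalued submodular valuation has the form `|S| + (c - 1) r(S)` for a matroid rank
function `r`, and `β_i` is this rank function. Hence the utilities which allocations can give are
`c * y i + w i`, where `y` is the vector of bundle sizes of a *clean* allocation (every bundle is
independent) and `w i` counts further goods, with `∑ y + ∑ w ≤ m`.

*Matroids.* A shortest path of the exchange graph has no shortcuts, and augmenting along it one
good at a time keeps all bundles independent (`Chordless.augment`). If no unallocated good can be
reached from `i`, then `i` and the holders of the reachable goods form a tight set: no clean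
allocation gives these agents more goods in total (`exists_isTight_of_forall_reachable`). So the
agents that leave `U` never again have a path, and provisional goods are worth exactly `1` to
their owners. Augmenting paths and tight sets together give the exchange property of the
vectors `y` (`Feasible.exchange`).

*Optimality.* Fix an arbitrary allocation with utility vector `u₀`. Throughout a run, if `x` and
`z` count the goods of `X^c` and `X^1`, there are `y ≥ x` and `w ≥ z` for which the utilities
`c * y i + w i` are feasible and have at least the Nash welfare of `u₀` (`CanMatch`). When the
algorithm raises a coordinate which `y` or `w` does not exceed, goods are moved to this agent from
an agent where `y` exceeds `x` or `w` exceeds `z`; the greedy choice of the agent ensures that the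
welfare does not drop (`CanMatch.transfer`, `CanMatch.provisional`). In the delicate case a good
of value `c` moves from `j` to `l` and raises `l` above the old utility of `j`; then `l` returns
`c` goods of value `1`, or else `l` and `j` swap utilities (`CanMatch.move`). At the end
all goods are used, so `y = x` and `w = z`.

The lexicographic comparison (number of positive utilities, then their product) is handled by
replacing zero utilities with a small `ε` and comparing products for all `ε ≤ 1 / 2` (`NashLE`).
-/

namespace YankeeSwap

/-! ### Matroid rank functions -/

/-- `r` is the rank function of a matroid on `G`; the axioms are stated for the marginal gain
of a single element. -/
structure IsRank {G : Type*} [DecidableEq G] (r : Finset G → ℕ) : Prop where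
  empty : r ∅ = 0
  le_insert : ∀ S g, r S ≤ r (insert g S)
  insert_le : ∀ S g, r (insert g S) ≤ r S + 1
  diminishing : ∀ S T g, S ⊆ T → r (insert g T) + r S ≤ r (insert g S) + r T

namespace IsRank

variable {G : Type*} [DecidableEq G] {r : Finset G → ℕ}

lemma le_union (hr : IsRank r) (S B : Finset G) : r S ≤ r (S ∪ B) := by
  induction B using Finset.induction_on with
  | empty => simp
  | insert g B _ ih => rw [Finset.union_insert]; exact ih.trans (hr.le_insert _ _)

lemma mono (hr : IsRank r) {S T : Finset G} (h : S ⊆ T) : r S ≤ r T := by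
  have := hr.le_union S T
  rwa [Finset.union_eq_right.2 h] at this

lemma union_le (hr : IsRank r) (S B : Finset G) : r (S ∪ B) ≤ r S + B.card := by
  induction B using Finset.induction_on with
  | empty => simp
  | insert g B hg ih =>
    rw [Finset.union_insert, Finset.card_insert_of_notMem hg]
    have := hr.insert_le (S ∪ B) g
    omega

lemma le_card (hr : IsRank r) (S : Finset G) : r S ≤ S.card := by
  have := hr.union_le ∅ S
  rw [Finset.empty_union, hr.empty] at this
  omega

lemma union_diminishing (hr : IsRank r) {S T : Finset G} (h : S ⊆ T) (B : Finset G) :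
    r (T ∪ B) + r S ≤ r (S ∪ B) + r T := by
  induction B using Finset.induction_on with
  | empty => simp [add_comm]
  | insert g B _ ih =>
    rw [Finset.union_insert, Finset.union_insert]
    have := hr.diminishing (S ∪ B) (T ∪ B) g (Finset.union_subset_union_left h)
    omega

lemma submodular (hr : IsRank r) (S T : Finset G) :
    r (S ∪ T) + r (S ∩ T) ≤ r S + r T := by
  have := hr.union_diminishing (Finset.inter_subset_left : S ∩ T ⊆ S) T
  rw [Finset.union_eq_right.2 (Finset.inter_subset_right : S ∩ T ⊆ T)] at this
  omega

lemma indep_subset (hr : IsRank r) {S T : Finset G} (h : S ⊆ T) (hT : r T = T.card) :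
    r S = S.card := by
  have h1 := hr.union_le S (T \ S)
  rw [Finset.union_sdiff_of_subset h, Finset.card_sdiff_of_subset h] at h1
  have h2 := hr.le_card S
  have := Finset.card_le_card h
  omega

lemma union_eq_of_forall_insert_eq (hr : IsRank r) {S B : Finset G}
    (h : ∀ g ∈ B, r (insert g S) = r S) : r (S ∪ B) = r S := by
  induction B using Finset.induction_on with
  | empty => simp
  | insert g B _ ih =>
    have h1 := ih fun k hk => h k (Finset.mem_insert_of_mem hk)
    have h2 := h g (Finset.mem_insert_self _ _)
    have h3 := hr.diminishing S (S ∪ B) g Finset.subset_union_left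
    have h4 := hr.le_insert (S ∪ B) g
    rw [Finset.union_insert]
    omega

lemma exists_basis (hr : IsRank r) (S : Finset G) :
    ∃ T ⊆ S, r T = T.card ∧ T.card = r S := by
  induction S using Finset.induction_on with
  | empty => exact ⟨∅, subset_rfl, by simp [hr.empty], by simp [hr.empty]⟩
  | insert g S hg ih =>
    obtain ⟨T, hTS, hT, hc⟩ := ih
    have h1 := hr.insert_le S g
    have h2 := hr.le_insert S g
    by_cases h : r (insert g S) = r S
    · exact ⟨T, hTS.trans (Finset.subset_insert _ _), hT, by omega⟩
    · have h3 := hr.diminishing T S g hTS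
      have h4 := hr.insert_le T g
      have hgT : g ∉ T := fun hgT => hg (hTS hgT)
      refine ⟨insert g T, Finset.insert_subset_insert g hTS, ?_, ?_⟩ <;>
        rw [Finset.card_insert_of_notMem hgT] <;> omega

/-- Adding to an independent set `I` an element `a` outside its span does not change which
exchanges `I - g + h` with `h` in the span of `I` keep the rank. -/
lemma exchange_insert_iff (hr : IsRank r) {I : Finset G} {a g h : G} (hI : r I = I.card)
    (ha : r (insert a I) = r I + 1) (hh : r (insert h I) = r I) (hga : g ≠ a) :
    r (insert h ((insert a I).erase g)) = r (insert a I) ↔ r (insert h (I.erase g)) = r I := by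
  have e1 : insert h ((insert a I).erase g) = insert a (insert h (I.erase g)) := by
    rw [Finset.erase_insert_of_ne hga.symm, Finset.insert_comm]
  have h1 := hr.insert_le (insert h (I.erase g)) a
  have h2 := hr.le_insert (insert h (I.erase g)) a
  have hsub : insert h (I.erase g) ⊆ insert h I :=
    Finset.insert_subset_insert _ (Finset.erase_subset _ _)
  have h3 := hr.diminishing _ _ a hsub
  have h4 := hr.mono hsub
  have h5 : r (insert a I) ≤ r (insert a (insert h I)) :=
    hr.mono (Finset.insert_subset_insert _ (Finset.subset_insert _ _))
  rw [e1]
  omega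

/-- Deleting from an independent set `I` an element `a` that cannot be exchanged for `h` does
not change which exchanges `I - g + h` keep the rank. -/
lemma exchange_erase_iff (hr : IsRank r) {I : Finset G} {a g h : G} (hI : r I = I.card)
    (ha : a ∈ I) (hg : g ∈ I) (hga : g ≠ a) (hh : r (insert h (I.erase a)) ≠ r I) :
    r (insert h ((I.erase a).erase g)) = r (I.erase a) ↔ r (insert h (I.erase g)) = r I := by
  have hIa : r (I.erase a) = (I.erase a).card := hr.indep_subset (Finset.erase_subset _ _) hI
  have hIg : r (I.erase g) = (I.erase g).card := hr.indep_subset (Finset.erase_subset _ _) hI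
  have ca := Finset.card_erase_add_one ha
  have cg := Finset.card_erase_add_one hg
  have hha : h ≠ a := by
    rintro rfl
    exact hh (by rw [Finset.insert_erase ha])
  set A := insert h ((I.erase a).erase g) with hA
  have e1 : insert a A = insert h (I.erase g) := by
    rw [hA, Finset.insert_comm, Finset.erase_right_comm, Finset.insert_erase]
    exact Finset.mem_erase.2 ⟨hga.symm, ha⟩
  have e2 : insert g A = insert h (I.erase a) := by
    rw [hA, Finset.insert_comm, Finset.insert_erase]
    exact Finset.mem_erase.2 ⟨hga, hg⟩
  have e3 : insert a (insert g A) = insert h I := by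
    rw [e2, Finset.insert_comm, Finset.insert_erase ha]
  have h1 := hr.insert_le A a
  have h2 := hr.le_insert A g
  have h3 := hr.diminishing A (insert g A) a (Finset.subset_insert _ _)
  have h4 := hr.le_insert I h
  have h5 := hr.insert_le (I.erase a) h
  have h6 := hr.le_insert (I.erase a) h
  have h7 := hr.insert_le (I.erase g) h
  rw [e3] at h3
  rw [e1] at h1 h3
  rw [e2] at h2 h3
  omega

/-- If `h` is spanned by the independent set `I` and cannot be exchanged for any element of
`B ⊆ I`, then `h` is spanned by `I \ B`. -/
lemma insert_sdiff_le (hr : IsRank r) {I B : Finset G} {h : G} (hI : r I = I.card)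
    (hB : B ⊆ I) (hh : r (insert h I) = r I)
    (hex : ∀ g ∈ B, r (insert h (I.erase g)) ≠ r I) :
    r (insert h (I \ B)) + B.card ≤ I.card := by
  induction B using Finset.induction_on with
  | empty => simp [hh, hI]
  | insert g B hgB ih =>
    have h1 := ih (fun k hk => hB (Finset.mem_insert_of_mem hk))
      fun k hk => hex k (Finset.mem_insert_of_mem hk)
    have hgI : g ∈ I := hB (Finset.mem_insert_self _ _)
    have h2 := hex g (Finset.mem_insert_self _ _)
    have hhI : h ∉ insert g B := by
      intro hm
      exact hex h hm (by rw [Finset.insert_erase (hB hm)])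
    have h3 := hr.submodular (insert h (I \ B)) (insert h (I.erase g))
    have hu : insert h (I \ B) ∪ insert h (I.erase g) = insert h I := by
      ext k
      simp only [Finset.mem_union, Finset.mem_insert, Finset.mem_sdiff, Finset.mem_erase]
      by_cases hk : k = g
      · subst hk; tauto
      · tauto
    have hi : insert h (I \ B) ∩ insert h (I.erase g) = insert h (I \ insert g B) := by
      ext k
      simp only [Finset.mem_inter, Finset.mem_insert, Finset.mem_sdiff, Finset.mem_erase]
      tauto
    rw [hu, hi] at h3
    have h4 : r (insert h (I.erase g)) ≤ r (insert h I) :=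
      hr.mono (Finset.insert_subset_insert _ (Finset.erase_subset _ _))
    rw [Finset.card_insert_of_notMem hgB]
    omega

end IsRank

lemma isRank_card {G : Type*} [DecidableEq G] : IsRank (Finset.card : Finset G → ℕ) where
  empty := rfl
  le_insert S g := Finset.card_le_card (Finset.subset_insert _ _)
  insert_le S g := Finset.card_insert_le _ _
  diminishing S T g h := by
    by_cases hT : g ∈ T
    · rw [Finset.insert_eq_of_mem hT]
      have := Finset.card_le_card (Finset.subset_insert g S)
      omega
    · rw [Finset.card_insert_of_notMem hT, Finset.card_insert_of_notMem fun hS => hT (h hS)]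
      omega

/-! ### Bivalued submodular valuations and rank functions -/

section Valuation

variable {G : Type*} [DecidableEq G] {c : ℕ} {w : Finset G → ℝ} {r : Finset G → ℕ}

/-- A `(1, c)`-bivalued submodular valuation is `|S| + (c - 1) r(S)` for a matroid rank
function `r`. -/
lemma IsBivaluedSubmodular.exists_isRank (hc : 2 ≤ c) (hw : IsBivaluedSubmodular 1 (c : ℝ) w) :
    ∃ r : Finset G → ℕ, IsRank r ∧ ∀ S, w S = S.card + ((c : ℝ) - 1) * r S := by
  obtain ⟨h0, h1, h2⟩ := hw
  have hc' : (2 : ℝ) ≤ c := by exact_mod_cast hc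
  have key : ∀ S : Finset G, ∃ k : ℕ, w S = S.card + ((c : ℝ) - 1) * k := by
    intro S
    induction S using Finset.induction_on with
    | empty => exact ⟨0, by simp [h0]⟩
    | insert g S hg ih =>
      obtain ⟨k, hk⟩ := ih
      rw [Finset.card_insert_of_notMem hg]
      rcases h1 S g hg with h | h
      · exact ⟨k, by push_cast; linarith⟩
      · exact ⟨k + 1, by push_cast; linarith⟩
  choose r hr using key
  have step : ∀ (S : Finset G) (g : G), g ∉ S →
      w (insert g S) - w S = 1 + ((c : ℝ) - 1) * ((r (insert g S) : ℝ) - r S) := by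
    intro S g hg
    rw [hr, hr, Finset.card_insert_of_notMem hg]
    push_cast
    ring
  have inc : ∀ (S : Finset G) (g : G),
      r (insert g S) = r S ∨ r (insert g S) = r S + 1 := by
    intro S g
    by_cases hg : g ∈ S
    · left; rw [Finset.insert_eq_of_mem hg]
    have h3 := step S g hg
    rcases h1 S g hg with h | h
    · left
      have : ((c : ℝ) - 1) * ((r (insert g S) : ℝ) - r S) = 0 := by linarith
      rcases mul_eq_zero.1 this with h' | h'
      · linarith
      · exact_mod_cast (sub_eq_zero.1 h')
    · right
      have : ((c : ℝ) - 1) * ((r (insert g S) : ℝ) - r S - 1) = 0 := by linarith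
      rcases mul_eq_zero.1 this with h' | h'
      · linarith
      · have : (r (insert g S) : ℝ) = r S + 1 := by linarith
        exact_mod_cast this
  refine ⟨r, ⟨?_, ?_, ?_, ?_⟩, hr⟩
  · have := hr ∅
    rw [h0, Finset.card_empty, Nat.cast_zero, zero_add] at this
    rcases mul_eq_zero.1 this.symm with h' | h'
    · linarith
    · exact_mod_cast h'
  · intro S g; rcases inc S g with h | h <;> omega
  · intro S g; rcases inc S g with h | h <;> omega
  · intro S T g hST
    by_cases hg : g ∈ T
    · rw [Finset.insert_eq_of_mem hg]
      rcases inc S g with h | h <;> omega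
    · have h3 := h2 S T g hST hg
      rw [step T g hg, step S g fun h => hg (hST h)] at h3
      have h4 : (r (insert g T) : ℝ) - r T ≤ (r (insert g S) : ℝ) - r S :=
        le_of_mul_le_mul_left (by linarith) (by linarith : (0 : ℝ) < (c : ℝ) - 1)
      have h5 : (r (insert g T) : ℝ) + r S ≤ r (insert g S) + r T := by linarith
      exact_mod_cast h5

lemma beta_eq_rank (hc : 2 ≤ c) (hr : IsRank r)
    (hw : ∀ S, w S = S.card + ((c : ℝ) - 1) * r S) (S : Finset G) : beta (c : ℝ) w S = r S := by
  have hc' : (2 : ℝ) ≤ c := by exact_mod_cast hc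
  have key : ∀ T : Finset G, w T = c * T.card ↔ r T = T.card := by
    intro T
    rw [hw]
    constructor
    · intro h
      have : ((c : ℝ) - 1) * ((r T : ℝ) - T.card) = 0 := by linarith
      rcases mul_eq_zero.1 this with h' | h'
      · linarith
      · exact_mod_cast sub_eq_zero.1 h'
    · intro h; rw [h]; ring
  unfold beta
  apply le_antisymm
  · apply Finset.sup_le
    intro T hT
    rw [Finset.mem_filter, Finset.mem_powerset] at hT
    rw [← (key T).1 hT.2]
    exact hr.mono hT.1
  · obtain ⟨T, hTS, hT, hcard⟩ := hr.exists_basis S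
    rw [← hcard]
    exact Finset.le_sup (f := Finset.card)
      (Finset.mem_filter.2 ⟨Finset.mem_powerset.2 hTS, (key T).2 hT⟩)

end Valuation

/-! ### Shortest paths and chordless paths -/

section Paths

variable {G : Type*}

/-- `p` is a path of the relation `E` from a point of `S` to a point of `T`. -/
def IsPath (E : G → G → Prop) (S T : G → Prop) (p : List G) : Prop :=
  p.IsChain E ∧ (∃ g ∈ p.head?, S g) ∧ ∃ g ∈ p.getLast?, T g

/-- `p` is a path of the relation `E` from `S` to `T` without shortcuts: only its first point
lies in `S`, only its last point lies in `T`, and the only edges leading forward along `p`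
are those between consecutive points. The recursion treats the successors of the first point
as the new set of starting points. -/
def Chordless (E : G → G → Prop) (T : G → Prop) : (G → Prop) → List G → Prop
  | _, [] => False
  | S, [g] => S g ∧ T g
  | S, g :: g' :: p => S g ∧ ¬ T g ∧ (∀ h ∈ g' :: p, ¬ S h) ∧ Chordless E T (E g) (g' :: p)

variable {E E' : G → G → Prop} {S S' T T' : G → Prop}

lemma Chordless.congr {p : List G} (hp : Chordless E T S p) (hS : ∀ g ∈ p, S g ↔ S' g)
    (hT : ∀ g ∈ p, T g ↔ T' g) (hE : ∀ g ∈ p, ∀ h ∈ p.tail, E g h ↔ E' g h) :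
    Chordless E' T' S' p := by
  induction p generalizing S S' with
  | nil => exact hp
  | cons g p ih =>
    cases p with
    | nil => exact ⟨(hS g (by simp)).1 hp.1, (hT g (by simp)).1 hp.2⟩
    | cons g' p =>
      obtain ⟨h1, h2, h3, h4⟩ := hp
      refine ⟨(hS g (by simp)).1 h1, fun h => h2 ((hT g (by simp)).2 h),
        fun h hh hs => h3 h hh ((hS h (List.mem_cons_of_mem _ hh)).2 hs), ?_⟩
      exact ih h4 (fun h hh => hE g (by simp) h hh)
        (fun h hh => hT h (List.mem_cons_of_mem _ hh))
        fun h hh k hk => hE h (List.mem_cons_of_mem _ hh) k (List.mem_cons_of_mem _ hk)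

lemma IsPath.chordless_of_shortest {p : List G} (hp : IsPath E S T p)
    (hmin : ∀ q, IsPath E S T q → p.length ≤ q.length) : Chordless E T S p := by
  induction p generalizing S with
  | nil => obtain ⟨_, ⟨g, hg, _⟩, _⟩ := hp; simp at hg
  | cons g p ih =>
    obtain ⟨hch, ⟨a, ha, hSa⟩, ⟨b, hb, hTb⟩⟩ := hp
    obtain rfl : g = a := by simpa using ha
    cases p with
    | nil =>
      obtain rfl : g = b := by simpa using hb
      exact ⟨hSa, hTb⟩
    | cons g' p =>
      rw [List.isChain_cons_cons] at hch
      rw [List.getLast?_cons_cons] at hb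
      refine ⟨hSa, ?_, ?_, ?_⟩
      · intro hT
        have := hmin [g] ⟨by simp, ⟨g, by simp, hSa⟩, ⟨g, by simp, hT⟩⟩
        simp at this
      · intro h hh hSh
        obtain ⟨l₁, l₂, hl⟩ := List.append_of_mem hh
        have hc : (h :: l₂).IsChain E := by
          have := hch.2
          rw [hl] at this
          exact this.right_of_append
        have hlast : b ∈ (h :: l₂).getLast? := by
          rw [hl, List.getLast?_append_cons] at hb
          exact hb
        have := hmin (h :: l₂) ⟨hc, ⟨h, by simp, hSh⟩, ⟨b, hlast, hTb⟩⟩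
        have hlen := congrArg List.length hl
        simp only [List.length_cons, List.length_append] at this hlen
        omega
      · refine ih ⟨hch.2, ⟨g', by simp, hch.1⟩, ⟨b, hb, hTb⟩⟩ ?_
        rintro q ⟨hqc, ⟨q₀, hq₀, hEq⟩, ⟨q₁, hq₁, hTq⟩⟩
        cases q with
        | nil => simp at hq₀
        | cons k q =>
          obtain rfl : k = q₀ := by simpa using hq₀
          have := hmin (g :: k :: q) ⟨List.isChain_cons_cons.2 ⟨hEq, hqc⟩, ⟨g, by simp, hSa⟩,
            ⟨q₁, by rwa [List.getLast?_cons_cons], hTq⟩⟩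
          simpa using this

lemma exists_isPath_of_reflTransGen {a b : G} (ha : S a) (hab : Relation.ReflTransGen E a b)
    (hb : T b) : ∃ p, IsPath E S T p := by
  obtain ⟨l, hl, hlast⟩ := List.exists_isChain_cons_of_relationReflTransGen hab
  exact ⟨a :: l, hl, ⟨a, by simp, ha⟩,
    ⟨b, by rw [← hlast]; simp [List.getLast?_eq_some_getLast], hb⟩⟩

lemma exists_shortest_isPath (h : ∃ p, IsPath E S T p) :
    ∃ p, IsPath E S T p ∧ ∀ q, IsPath E S T q → p.length ≤ q.length := by
  obtain ⟨p, hp, hmin⟩ := exists_minimalFor_of_wellFoundedLT (IsPath E S T) List.length h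
  exact ⟨p, hp, fun q hq => (le_total p.length q.length).elim id (hmin hq)⟩

end Paths

/-! ### Path augmentation -/

lemma mem_bundle {n : ℕ} {G : Type*} [Fintype G] {X : Allocation n G} {j : Option (Fin n)}
    {g : G} : g ∈ bundle X j ↔ X g = j := by simp [bundle]

section

variable {n : ℕ} {G : Type*} [DecidableEq G] {X : Allocation n G} {i j : Option (Fin n)} {g : G}

lemma update_augment {p : List G} (hg : g ∉ p) :
    Function.update (augment X j p) g i = augment (Function.update X g i) j p := by
  induction p generalizing j with
  | nil => rfl
  | cons h p ih =>
    rw [List.mem_cons, not_or] at hg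
    rw [augment, augment, Function.update_comm (Ne.symm hg.1), ih hg.2,
      Function.update_of_ne (Ne.symm hg.1)]

lemma augment_cons {p : List G} (hg : g ∉ p) :
    augment X i (g :: p) = augment (Function.update X g i) (X g) p := by
  rw [augment, update_augment hg]

end

section Augment

variable {n : ℕ} {G : Type*} [Fintype G] [DecidableEq G]

/-- The exchange graph of `X` for the rank functions `r`. -/
def RankEdge (r : Option (Fin n) → Finset G → ℕ) (X : Allocation n G) (g h : G) : Prop :=
  r (X g) (insert h ((bundle X (X g)).erase g)) = r (X g) (bundle X (X g))

/-- `h` lies outside the span of the bundle of `i`. -/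
def RankGain (r : Option (Fin n) → Finset G → ℕ) (X : Allocation n G) (i : Option (Fin n))
    (h : G) : Prop :=
  r i (insert h (bundle X i)) = r i (bundle X i) + 1

/-- Every bundle of `X` is independent. -/
def IsClean (r : Option (Fin n) → Finset G → ℕ) (X : Allocation n G) : Prop :=
  ∀ k, r k (bundle X k) = (bundle X k).card

variable {r : Option (Fin n) → Finset G → ℕ} {X : Allocation n G} {i j : Option (Fin n)}
  {g : G}

lemma bundle_update_self : bundle (Function.update X g i) i = insert g (bundle X i) := by
  ext h
  by_cases hg : h = g
  · subst hg; simp [mem_bundle]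
  · simp [mem_bundle, hg]

lemma bundle_update_of_ne (hij : i ≠ j) :
    bundle (Function.update X g i) j = (bundle X j).erase g := by
  ext h
  by_cases hg : h = g
  · subst hg; simp [mem_bundle, hij]
  · simp [mem_bundle, hg]

lemma bundle_update_of_ne_of_ne (hij : i ≠ j) (hg : X g ≠ j) :
    bundle (Function.update X g i) j = bundle X j := by
  rw [bundle_update_of_ne hij, Finset.erase_eq_of_notMem (by rwa [mem_bundle])]

lemma RankGain.ne (h : RankGain r X i g) : X g ≠ i := by
  intro hg
  rw [RankGain, Finset.insert_eq_of_mem (by rwa [mem_bundle])] at h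
  omega

lemma IsClean.update (hr : ∀ k, IsRank (r k)) (hX : IsClean r X) (hg : RankGain r X i g) :
    IsClean r (Function.update X g i) := by
  intro k
  by_cases hk : i = k
  · subst hk
    rw [bundle_update_self, hg, hX i,
      Finset.card_insert_of_notMem (by rw [mem_bundle]; exact hg.ne)]
  · rw [bundle_update_of_ne hk]
    exact (hr k).indep_subset (Finset.erase_subset _ _) (hX k)

/-- After the first good `g` of a chordless path is given to `i`, the rest of the path is
chordless, starting outside the span of the remaining bundle of the former holder of `g`. -/
lemma Chordless.update (hr : ∀ k, IsRank (r k)) (hX : IsClean r X) {g' : G}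
    {p : List G}
    (hp : Chordless (RankEdge r X) (fun h => X h = j) (RankGain r X i) (g :: g' :: p)) :
    Chordless (RankEdge r (Function.update X g i)) (fun h => Function.update X g i h = j)
      (RankGain r (Function.update X g i) (X g)) (g' :: p) := by
  obtain ⟨hg, hgj, hS, hp⟩ := hp
  have hne : ∀ h ∈ g' :: p, h ≠ g := by
    rintro h hh rfl
    exact hS _ hh hg
  have hgm : g ∈ bundle X (X g) := mem_bundle.2 rfl
  have hgi : X g ≠ i := hg.ne
  -- The successors of `g` other than the next good are cut off, by chordlessness.
  have hchord : ∀ h ∈ p, ¬ RankEdge r X g h := by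
    cases p with
    | nil => simp
    | cons g'' p => exact hp.2.2.1
  have hspan : ∀ h ∈ g' :: p, r i (insert h (bundle X i)) = r i (bundle X i) := by
    intro h hh
    have h1 := hS h hh
    have h2 := (hr i).le_insert (bundle X i) h
    have h3 := (hr i).insert_le (bundle X i) h
    rw [RankGain] at h1
    omega
  refine hp.congr ?_ ?_ ?_
  · intro h hh
    have h1 := (hr (X g)).indep_subset (Finset.erase_subset g _) (hX (X g))
    have h2 := Finset.card_erase_add_one hgm
    rw [RankEdge, RankGain, bundle_update_of_ne hgi.symm, hX (X g), h1, h2]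
  · intro h hh
    rw [Function.update_of_ne (hne h hh)]
  · intro a ha h hh
    have hag := hne a ha
    rw [RankEdge, RankEdge, Function.update_of_ne hag]
    have ham : a ∈ bundle X (X a) := mem_bundle.2 rfl
    by_cases hai : X a = i
    · rw [hai, bundle_update_self]
      exact ((hr i).exchange_insert_iff (hX i) hg
        (hspan h (List.mem_cons_of_mem _ hh)) hag).symm
    · by_cases hag' : X a = X g
      · rw [hag', bundle_update_of_ne hgi.symm]
        rw [hag'] at ham
        exact ((hr (X g)).exchange_erase_iff (hX (X g)) hgm ham hag (hchord h hh)).symm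
      · rw [bundle_update_of_ne_of_ne (Ne.symm hai) (Ne.symm hag')]

/-- Augmenting along a chordless path preserves independence of all bundles; `i` gains one
good, and the holder `j` of the last good loses exactly this good. -/
lemma Chordless.augment (hr : ∀ k, IsRank (r k)) (hX : IsClean r X) (hij : i ≠ j) {p : List G}
    (hp : Chordless (RankEdge r X) (fun h => X h = j) (RankGain r X i) p) :
    IsClean r (augment X i p) ∧
    (∀ k, k ≠ j → (bundle (augment X i p) k).card =
      (bundle X k).card + if k = i then 1 else 0) ∧
    ∀ t ∈ p.getLast?, X t = j ∧ bundle (augment X i p) j = (bundle X j).erase t := by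
  induction p generalizing X i with
  | nil => exact hp.elim
  | cons g p ih =>
    cases p with
    | nil =>
      have hg : RankGain r X i g := hp.1
      have hgj : X g = j := hp.2
      have haug : YankeeSwap.augment X i [g] = Function.update X g i := rfl
      rw [haug]
      refine ⟨hX.update hr hg, ?_, ?_⟩
      · intro k hk
        by_cases hki : k = i
        · subst hki
          rw [bundle_update_self,
            Finset.card_insert_of_notMem (by rw [mem_bundle]; exact hg.ne), if_pos rfl]
        · rw [bundle_update_of_ne_of_ne (Ne.symm hki) (by rw [hgj]; exact hk.symm), if_neg hki,
            add_zero]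
      · intro t ht
        obtain rfl : g = t := by simpa using ht
        exact ⟨hgj, bundle_update_of_ne hij⟩
    | cons g' p =>
      have hg : RankGain r X i g := hp.1
      have hgj : X g ≠ j := hp.2.1
      have hgp : g ∉ g' :: p := fun h => hp.2.2.1 g h hg
      have hgi : X g ≠ i := hg.ne
      rw [augment_cons hgp]
      obtain ⟨h1, h2, h3⟩ := ih (hX.update hr hg) hgj (hp.update hr hX)
      refine ⟨h1, ?_, ?_⟩
      · intro k hk
        rw [h2 k hk]
        by_cases hki : k = i
        · subst hki
          rw [bundle_update_self, if_neg hgi.symm, if_pos rfl,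
            Finset.card_insert_of_notMem (by rw [mem_bundle]; exact hgi)]
        · by_cases hkg : k = X g
          · rw [if_pos hkg, if_neg hki, bundle_update_of_ne (Ne.symm hki),
              Finset.card_erase_add_one (mem_bundle.2 hkg.symm)]
            rfl
          · rw [if_neg hkg, if_neg hki, bundle_update_of_ne_of_ne (Ne.symm hki) (Ne.symm hkg)]
      · intro t ht
        rw [List.getLast?_cons_cons] at ht
        obtain ⟨h4, h5⟩ := h3 t ht
        rw [bundle_update_of_ne_of_ne hij hgj] at h5
        refine ⟨?_, h5⟩
        have htg : t ≠ g := by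
          rintro rfl
          exact hgp (List.mem_of_mem_getLast? ht)
        rwa [Function.update_of_ne htg] at h4

end Augment

/-! ### Tight sets of agents and the exchange property of size vectors -/

lemma sum_card_bundle {n : ℕ} {G : Type*} [Fintype G] (X : Allocation n G) :
    (bundle X none).card + ∑ i : Fin n, (bundle X (some i)).card = Fintype.card G := by
  rw [← Fintype.sum_option fun j => (bundle X j).card]
  exact (Finset.card_eq_sum_card_fiberwise (f := X) (s := Finset.univ) (t := Finset.univ)
    (by simp)).symm

section Feasible

variable {n : ℕ} {G : Type*} [Fintype G] [DecidableEq G]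
  {r : Option (Fin n) → Finset G → ℕ} {X : Allocation n G} {i : Fin n}

/-- `h` can be reached in the exchange graph of `X` from the goods that `i` could use. -/
def IsReachable (r : Option (Fin n) → Finset G → ℕ) (X : Allocation n G) (i : Option (Fin n))
    (h : G) : Prop :=
  ∃ g, RankGain r X i g ∧ Relation.ReflTransGen (RankEdge r X) g h

/-- No clean allocation gives more goods in total to the agents of `A` than `X` does. -/
def IsTight (r : Option (Fin n) → Finset G → ℕ) (X : Allocation n G) (A : Finset (Fin n)) :
    Prop :=
  ∀ Y, IsClean r Y →
    ∑ j ∈ A, (bundle Y (some j)).card ≤ ∑ j ∈ A, (bundle X (some j)).card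

/-- `x` is the vector of bundle sizes of a clean allocation. These vectors are the integral
points of a polymatroid. -/
def Feasible (r : Option (Fin n) → Finset G → ℕ) (x : Fin n → ℕ) : Prop :=
  ∃ X, IsClean r X ∧ ∀ i, (bundle X (some i)).card = x i

lemma IsReachable.exists_chordless {i j : Option (Fin n)} {h : G} (hh : IsReachable r X i h)
    (hj : X h = j) : ∃ p, Chordless (RankEdge r X) (fun h => X h = j) (RankGain r X i) p := by
  obtain ⟨g, hg, hgh⟩ := hh
  obtain ⟨p, hp, hmin⟩ :=
    exists_shortest_isPath (exists_isPath_of_reflTransGen (T := fun h => X h = j) hg hgh hj)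
  exact ⟨p, hp.chordless_of_shortest hmin⟩

/-- If no unallocated good is reachable from `i`, then `i` together with the holders of the
reachable goods form a tight set: the unreachable goods held by such an agent span, for this
agent, all unreachable goods. -/
lemma exists_isTight_of_forall_reachable (hr : ∀ k, IsRank (r k)) (hX : IsClean r X)
    (h0 : ∀ h, IsReachable r X (some i) h → X h ≠ none) :
    ∃ A : Finset (Fin n), i ∈ A ∧
      (∀ j ∈ A, j ≠ i → ∃ h, IsReachable r X (some i) h ∧ X h = some j) ∧ IsTight r X A := by
  classical
  let R : Finset G := Finset.univ.filter (IsReachable r X (some i))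
  have hR : ∀ {h}, h ∈ R ↔ IsReachable r X (some i) h := by simp [R]
  let A : Finset (Fin n) := Finset.univ.filter fun j => j = i ∨ ∃ h ∈ R, X h = some j
  have hA : ∀ {j}, j ∈ A ↔ j = i ∨ ∃ h ∈ R, X h = some j := by simp [A]
  refine ⟨A, hA.2 (Or.inl rfl), ?_, ?_⟩
  · intro j hj hji
    obtain ⟨h, hh, hhj⟩ := (hA.1 hj).resolve_left hji
    exact ⟨h, hR.1 hh, hhj⟩
  have hspan : ∀ j ∈ A, r (some j) Rᶜ ≤ (bundle X (some j) \ R).card := by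
    intro j hj
    set B := bundle X (some j) with hB
    have hrk := hr (some j)
    have hBc : r (some j) B = B.card := hX (some j)
    have hBR : r (some j) (B \ R) = (B \ R).card := hrk.indep_subset Finset.sdiff_subset hBc
    -- No element of `B ∩ R` can be exchanged for an element outside `R`.
    have hex : ∀ h, h ∉ R → ∀ g ∈ B ∩ R,
        r (some j) (insert h (B.erase g)) ≠ r (some j) B := by
      intro h hh g hg hEq
      obtain ⟨hgB, hgR⟩ := Finset.mem_inter.1 hg
      obtain ⟨a, ha, hag⟩ := hR.1 hgR
      have hgj : X g = some j := mem_bundle.1 hgB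
      exact hh (hR.2 ⟨a, ha, hag.tail (by rw [RankEdge, hgj]; exact hEq)⟩)
    have hone : ∀ h ∈ Rᶜ, r (some j) (insert h (B \ R)) = r (some j) (B \ R) := by
      intro h hh
      have hhR : h ∉ R := Finset.mem_compl.1 hh
      have hsp : r (some j) (insert h B) = r (some j) B := by
        have h1 := hrk.le_insert B h
        have h2 := hrk.insert_le B h
        rcases hA.1 hj with rfl | ⟨g, hgR, hgj⟩
        · have : r (some j) (insert h B) ≠ r (some j) B + 1 := fun hg =>
            hhR (hR.2 ⟨h, hg, Relation.ReflTransGen.refl⟩)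
          omega
        · have hgB : g ∈ B := mem_bundle.2 hgj
          have h3 := hex h hhR g (Finset.mem_inter.2 ⟨hgB, hgR⟩)
          have h4 := hrk.insert_le (insert h (B.erase g)) g
          rw [Finset.insert_comm, Finset.insert_erase hgB] at h4
          have h5 := hrk.insert_le (B.erase g) h
          have h6 := hrk.indep_subset (Finset.erase_subset g B) hBc
          have h7 := Finset.card_erase_add_one hgB
          omega
      have h1 := hrk.insert_sdiff_le hBc (Finset.inter_subset_left : B ∩ R ⊆ B) hsp (hex h hhR)
      rw [Finset.sdiff_inter_self_left] at h1
      have h2 := Finset.card_sdiff_add_card_inter B R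
      have h3 := hrk.le_insert (B \ R) h
      omega
    calc r (some j) Rᶜ ≤ r (some j) (B \ R ∪ Rᶜ) := hrk.mono Finset.subset_union_right
      _ = (B \ R).card := by rw [hrk.union_eq_of_forall_insert_eq hone, hBR]
  intro Y hY
  have hYj : ∀ j ∈ A, (bundle Y (some j) \ R).card ≤ (bundle X (some j) \ R).card := by
    intro j hj
    have h1 := (hr (some j)).indep_subset (Finset.sdiff_subset : bundle Y (some j) \ R ⊆ _)
      (hY (some j))
    have h2 := (hr (some j)).mono
      (fun g hg => Finset.mem_compl.2 (Finset.mem_sdiff.1 hg).2 : bundle Y (some j) \ R ⊆ Rᶜ)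
    have h3 := hspan j hj
    omega
  have hsum : ∀ Z : Allocation n G,
      ∑ j ∈ A, (bundle Z (some j) ∩ R).card = (R.filter fun g => ∃ j ∈ A, Z g = some j).card := by
    intro Z
    rw [← Finset.card_biUnion]
    · congr 1
      ext g
      simp only [Finset.mem_biUnion, Finset.mem_inter, mem_bundle, Finset.mem_filter]
      tauto
    · intro a _ b _ hab
      refine Finset.disjoint_left.2 fun g hga hgb => hab ?_
      have h1 := mem_bundle.1 (Finset.mem_inter.1 hga).1
      have h2 := mem_bundle.1 (Finset.mem_inter.1 hgb).1
      exact Option.some.inj (h1.symm.trans h2)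
  have hXR : (R.filter fun g => ∃ j ∈ A, X g = some j) = R := by
    refine Finset.filter_true_of_mem fun g hg => ?_
    obtain ⟨j, hj⟩ := Option.ne_none_iff_exists'.1 (h0 g (hR.1 hg))
    exact ⟨j, hA.2 (Or.inr ⟨g, hg, hj⟩), hj⟩
  have hsplit : ∀ Z : Allocation n G, ∑ j ∈ A, (bundle Z (some j)).card =
      ∑ j ∈ A, (bundle Z (some j) \ R).card + ∑ j ∈ A, (bundle Z (some j) ∩ R).card := by
    intro Z
    rw [← Finset.sum_add_distrib]
    exact Finset.sum_congr rfl fun j _ => (Finset.card_sdiff_add_card_inter _ _).symm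
  rw [hsplit Y, hsplit X, hsum Y, hsum X, hXR]
  exact add_le_add (Finset.sum_le_sum hYj) (Finset.card_le_card (Finset.filter_subset _ _))

lemma Feasible.of_add_single (hr : ∀ k, IsRank (r k)) (hnone : r none = Finset.card)
    {x : Fin n → ℕ} (hx : Feasible r (x + Pi.single i 1)) : Feasible r x := by
  obtain ⟨X, hX, hcard⟩ := hx
  have hi := hcard i
  simp only [Pi.add_apply, Pi.single_eq_same] at hi
  obtain ⟨g, hg⟩ : (bundle X (some i)).Nonempty := Finset.card_pos.1 (by omega)
  have hgi := mem_bundle.1 hg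
  have hne : ∀ j : Fin n, (none : Option (Fin n)) ≠ some j := by simp
  refine ⟨Function.update X g none, ?_, ?_⟩
  · rintro (_ | k)
    · rw [hnone]
    · rw [bundle_update_of_ne (hne k)]
      exact (hr _).indep_subset (Finset.erase_subset _ _) (hX _)
  · intro k
    by_cases hk : k = i
    · subst hk
      have := Finset.card_erase_add_one hg
      rw [bundle_update_of_ne (hne k)]
      omega
    · rw [bundle_update_of_ne_of_ne (hne k) (by rw [hgi]; simpa using Ne.symm hk), hcard]
      simp [hk]

/-- The exchange property of the integral points of a polymatroid. -/
lemma Feasible.exchange (hr : ∀ k, IsRank (r k)) {x y : Fin n → ℕ} (hx : Feasible r x)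
    (hy : Feasible r y) {l : Fin n} (hl : y l < x l) :
    Feasible r (y + Pi.single l 1) ∨ ∃ (j : Fin n) (y₀ : Fin n → ℕ), j ≠ l ∧ x j < y j ∧
      y = y₀ + Pi.single j 1 ∧ Feasible r (y₀ + Pi.single l 1) := by
  obtain ⟨X, hX, hXx⟩ := hx
  obtain ⟨Y, hY, hYy⟩ := hy
  by_cases h0 : ∀ h, IsReachable r Y (some l) h → Y h ≠ none
  · right
    obtain ⟨A, hlA, hA, htight⟩ := exists_isTight_of_forall_reachable hr hY h0
    have hsum := htight X hX
    simp only [hXx, hYy] at hsum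
    obtain ⟨j, hjA, hj⟩ : ∃ j ∈ A, x j < y j := by
      by_contra! hcon
      exact absurd (Finset.sum_lt_sum hcon ⟨l, hlA, hl⟩) (not_lt.2 hsum)
    have hjl : j ≠ l := by rintro rfl; omega
    obtain ⟨h, hh, hhj⟩ := hA j hjA hjl
    obtain ⟨p, hp⟩ := hh.exists_chordless hhj
    have hlj : some l ≠ some j := by simpa using hjl.symm
    obtain ⟨h1, h2, h3⟩ := hp.augment hr hY hlj
    have hpne : p ≠ [] := by rintro rfl; exact hp
    obtain ⟨htj, ht⟩ := h3 (p.getLast hpne) (List.getLast?_eq_some_getLast hpne)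
    refine ⟨j, fun k => if k = j then y k - 1 else y k, hjl, hj, ?_,
      YankeeSwap.augment Y (some l) p, h1, ?_⟩
    · funext k
      by_cases hk : k = j
      · subst hk; simp; omega
      · simp [hk]
    · intro k
      by_cases hk : k = j
      · subst hk
        rw [ht, Finset.card_erase_of_mem (mem_bundle.2 htj), hYy]
        simp [hjl]
      · rw [h2 (some k) (by simpa using hk), hYy]
        simp [hk, Pi.single_apply]
  · left
    push Not at h0
    obtain ⟨h, hh, hhn⟩ := h0
    obtain ⟨p, hp⟩ := hh.exists_chordless hhn
    obtain ⟨h1, h2, -⟩ := hp.augment hr hY (by simp)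
    refine ⟨YankeeSwap.augment Y (some l) p, h1, fun k => ?_⟩
    rw [h2 (some k) (by simp), hYy]
    simp [Pi.single_apply]

/-- Every bundle contains an independent set of the size of its rank. -/
lemma feasible_rank (hr : ∀ k, IsRank (r k)) (hnone : r none = Finset.card)
    (Y : Allocation n G) : Feasible r fun i => r (some i) (bundle Y (some i)) := by
  choose T hTY hT hcard using fun i : Fin n => (hr (some i)).exists_basis (bundle Y (some i))
  let X : Allocation n G := fun g => (Y g).bind fun i => if g ∈ T i then some i else none
  have hX : ∀ i, bundle X (some i) = T i := by
    intro i
    ext g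
    rw [mem_bundle]
    constructor
    · intro h
      obtain ⟨a, -, h2⟩ := Option.bind_eq_some_iff.1 h
      by_cases hga : g ∈ T a
      · rw [if_pos hga] at h2
        rwa [← Option.some.inj h2]
      · simp [hga] at h2
    · intro h
      have : Y g = some i := mem_bundle.1 (hTY i h)
      simp [X, this, h]
  refine ⟨X, ?_, fun i => by rw [hX, hcard]⟩
  rintro (_ | i)
  · rw [hnone]
  · rw [hX, hT]

end Feasible

/-! ### Comparing utility vectors -/

section Nash

/-- The utility `k` with zero replaced by the small number `ε`. -/
noncomputable def smoothed (ε : ℝ) (k : ℕ) : ℝ := if k = 0 then ε else k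

/-- `u'` has at least the Nash welfare of `u` for all small replacement values of zero. -/
def NashLE {n : ℕ} (u u' : Fin n → ℕ) : Prop :=
  ∀ ε : ℝ, 0 < ε → ε ≤ 1 / 2 → ∏ i, smoothed ε (u i) ≤ ∏ i, smoothed ε (u' i)

variable {n : ℕ} {u u' u'' : Fin n → ℕ} {ε : ℝ} {a b c k : ℕ}

lemma smoothed_zero : smoothed ε 0 = ε := if_pos rfl

lemma smoothed_of_pos (h : 0 < k) : smoothed ε k = k := if_neg h.ne'

lemma smoothed_pos (h : 0 < ε) (k : ℕ) : 0 < smoothed ε k := by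
  rcases Nat.eq_zero_or_pos k with rfl | hk
  · rwa [smoothed_zero]
  · rw [smoothed_of_pos hk]; exact_mod_cast hk

lemma smoothed_mono (h : ε ≤ 1 / 2) (hab : a ≤ b) : smoothed ε a ≤ smoothed ε b := by
  rcases Nat.eq_zero_or_pos a with rfl | ha
  · rcases Nat.eq_zero_or_pos b with rfl | hb
    · rfl
    · rw [smoothed_zero, smoothed_of_pos hb]
      have : (1 : ℝ) ≤ b := by exact_mod_cast hb
      linarith
  · rw [smoothed_of_pos ha, smoothed_of_pos (ha.trans_le hab)]
    exact_mod_cast hab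

lemma NashLE.refl (u : Fin n → ℕ) : NashLE u u := fun _ _ _ => le_rfl

lemma NashLE.trans (h : NashLE u u') (h' : NashLE u' u'') : NashLE u u'' :=
  fun ε h0 h1 => (h ε h0 h1).trans (h' ε h0 h1)

lemma NashLE.of_le (h : u ≤ u') : NashLE u u' := fun _ h0 h1 =>
  Finset.prod_le_prod (fun _ _ => (smoothed_pos h0 _).le) fun i _ => smoothed_mono h1 (h i)

lemma NashLE.of_perm (σ : Equiv.Perm (Fin n)) (h : ∀ i, u' i = u (σ i)) : NashLE u u' := by
  intro ε _ _
  simp only [h]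
  exact (Equiv.prod_comp σ fun i => smoothed ε (u i)).ge

lemma NashLE.of_pair {l j : Fin n} (hlj : j ≠ l) (h : ∀ i, i ≠ l → i ≠ j → u' i = u i)
    (hp : ∀ ε : ℝ, 0 < ε → ε ≤ 1 / 2 →
      smoothed ε (u l) * smoothed ε (u j) ≤ smoothed ε (u' l) * smoothed ε (u' j)) :
    NashLE u u' := by
  intro ε h0 h1
  have key : ∀ f : Fin n → ℝ,
      ∏ i, f i = f l * f j * ∏ i ∈ (Finset.univ.erase l).erase j, f i := by
    intro f
    rw [mul_assoc, Finset.mul_prod_erase _ f (Finset.mem_erase.2 ⟨hlj, Finset.mem_univ j⟩),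
      Finset.mul_prod_erase _ f (Finset.mem_univ l)]
  rw [key, key fun i => smoothed ε (u' i)]
  have hrest : ∏ i ∈ (Finset.univ.erase l).erase j, smoothed ε (u' i) =
      ∏ i ∈ (Finset.univ.erase l).erase j, smoothed ε (u i) := by
    refine Finset.prod_congr rfl fun i hi => ?_
    rw [Finset.mem_erase, Finset.mem_erase] at hi
    rw [h i hi.2.1 hi.1]
  rw [hrest]
  exact mul_le_mul_of_nonneg_right (hp ε h0 h1)
    (Finset.prod_nonneg fun i _ => (smoothed_pos h0 _).le)

/-- Raising `a` by `c` makes up for lowering `b + 1` by `1`. -/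
lemma smoothed_mul_le_gain_lose_one (hc : 1 ≤ c) (hab : a ≤ c * b) (h0 : 0 < ε)
    (h1 : ε ≤ 1 / 2) :
    smoothed ε a * smoothed ε (b + 1) ≤ smoothed ε (a + c) * smoothed ε b := by
  rw [smoothed_of_pos (by omega : 0 < b + 1), smoothed_of_pos (by omega : 0 < a + c)]
  have hc' : (1 : ℝ) ≤ c := by exact_mod_cast hc
  have hab' : (a : ℝ) ≤ c * b := by exact_mod_cast hab
  rcases Nat.eq_zero_or_pos b with rfl | hb
  · obtain rfl : a = 0 := by simpa using hab
    rw [smoothed_zero]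
    push_cast
    nlinarith [h0]
  · have hb' : (1 : ℝ) ≤ b := by exact_mod_cast hb
    rw [smoothed_of_pos hb]
    rcases Nat.eq_zero_or_pos a with rfl | ha
    · rw [smoothed_zero]
      push_cast
      nlinarith
    · rw [smoothed_of_pos ha]
      push_cast
      nlinarith

/-- Raising `a` by `1` makes up for lowering `b + c` by `c`. -/
lemma smoothed_mul_le_gain_one_lose (hab : c * a ≤ b) (hb : 0 < b) (hcb : c ≤ b)
    (h1 : ε ≤ 1 / 2) :
    smoothed ε a * smoothed ε (b + c) ≤ smoothed ε (a + 1) * smoothed ε b := by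
  rw [smoothed_of_pos (by omega : 0 < b + c), smoothed_of_pos (by omega : 0 < a + 1),
    smoothed_of_pos hb]
  have hab' : (c : ℝ) * a ≤ b := by exact_mod_cast hab
  have hcb' : (c : ℝ) ≤ b := by exact_mod_cast hcb
  have hb' : (1 : ℝ) ≤ b := by exact_mod_cast hb
  have hc' : (0 : ℝ) ≤ c := Nat.cast_nonneg c
  rcases Nat.eq_zero_or_pos a with rfl | ha
  · rw [smoothed_zero]
    push_cast
    nlinarith
  · rw [smoothed_of_pos ha]
    push_cast
    nlinarith

/-- Raising `a` by `c` makes up for lowering `b + c` by `c`. -/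
lemma smoothed_mul_le_gain_lose (hc : 1 ≤ c) (hab : a ≤ b) (h1 : ε ≤ 1 / 2) :
    smoothed ε a * smoothed ε (b + c) ≤ smoothed ε (a + c) * smoothed ε b := by
  rw [smoothed_of_pos (by omega : 0 < b + c), smoothed_of_pos (by omega : 0 < a + c)]
  have hc' : (1 : ℝ) ≤ c := by exact_mod_cast hc
  have hab' : (a : ℝ) ≤ b := by exact_mod_cast hab
  rcases Nat.eq_zero_or_pos b with rfl | hb
  · obtain rfl : a = 0 := by omega
    rw [smoothed_zero]
    push_cast
    nlinarith
  · have hb' : (1 : ℝ) ≤ b := by exact_mod_cast hb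
    rw [smoothed_of_pos hb]
    rcases Nat.eq_zero_or_pos a with rfl | ha
    · rw [smoothed_zero]
      push_cast
      nlinarith [mul_nonneg (sub_nonneg.2 hb') (sub_nonneg.2 hc')]
    · rw [smoothed_of_pos ha]
      push_cast
      nlinarith

/-- Comparing for all small replacement values of zero is stronger than first comparing the
numbers of positive utilities, and then their products. -/
lemma NashLE.nashGE (h : NashLE u u') : NashGE (fun i => (u' i : ℝ)) fun i => (u i : ℝ) := by
  have key : ∀ (w : Fin n → ℕ) (ε : ℝ), ∏ i, smoothed ε (w i) =
      (∏ i ∈ positiveAgents fun i => (w i : ℝ), (w i : ℝ)) *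
        ε ^ (n - (positiveAgents fun i => (w i : ℝ)).card) := by
    intro w ε
    rw [← Finset.prod_mul_prod_compl (positiveAgents fun i => (w i : ℝ))]
    congr 1
    · refine Finset.prod_congr rfl fun i hi => smoothed_of_pos ?_
      simpa [positiveAgents] using hi
    · have : ∀ i ∈ (positiveAgents fun i => (w i : ℝ))ᶜ, smoothed ε (w i) = ε := by
        intro i hi
        have : w i = 0 := by simpa [positiveAgents] using hi
        rw [this, smoothed_zero]
      rw [Finset.prod_congr rfl this, Finset.prod_const, Finset.card_compl, Fintype.card_fin]
  have hone : ∀ w : Fin n → ℕ, 1 ≤ ∏ i ∈ positiveAgents fun i => (w i : ℝ), (w i : ℝ) := by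
    intro w
    refine Finset.one_le_prod fun i hi => ?_
    have : 0 < w i := by simpa [positiveAgents] using hi
    exact_mod_cast this
  have hle : ∀ w : Fin n → ℕ, (positiveAgents fun i => (w i : ℝ)).card ≤ n := fun w =>
    (Finset.card_le_univ _).trans_eq (Fintype.card_fin n)
  set p := (positiveAgents fun i => (u i : ℝ)).card with hp
  set q := (positiveAgents fun i => (u' i : ℝ)).card with hq
  set A := ∏ i ∈ positiveAgents fun i => (u i : ℝ), (u i : ℝ) with hA
  set B := ∏ i ∈ positiveAgents fun i => (u' i : ℝ), (u' i : ℝ) with hB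
  have hA1 : 1 ≤ A := hone u
  have hB1 : 1 ≤ B := hone u'
  have hpn : p ≤ n := hle u
  have hqn : q ≤ n := hle u'
  have hcmp : ∀ ε : ℝ, 0 < ε → ε ≤ 1 / 2 → A * ε ^ (n - p) ≤ B * ε ^ (n - q) := by
    intro ε h0 h1
    have := h ε h0 h1
    rwa [key u, key u'] at this
  rcases lt_trichotomy p q with hlt | heq | hgt
  · exact Or.inl hlt
  · refine Or.inr ⟨heq.symm, ?_⟩
    have := hcmp (1 / 2) (by norm_num) le_rfl
    rw [heq] at this
    exact le_of_mul_le_mul_right this (by positivity)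
  · exfalso
    -- If `u` has more positive entries, then `ε < 1 / B` contradicts the comparison.
    have hε0 : (0 : ℝ) < 1 / (2 * B) := by positivity
    have hε1 : 1 / (2 * B) ≤ 1 / 2 := one_div_le_one_div_of_le (by norm_num) (by linarith)
    have h2 := hcmp _ hε0 hε1
    have hpow : (1 / (2 * B)) ^ (n - q) ≤ (1 / (2 * B)) ^ (n - p + 1) :=
      pow_le_pow_of_le_one hε0.le (by linarith) (by omega)
    have h3 : A * (1 / (2 * B)) ^ (n - p) ≤ 1 / 2 * (1 / (2 * B)) ^ (n - p) :=
      calc _ ≤ B * (1 / (2 * B)) ^ (n - q) := h2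
        _ ≤ B * (1 / (2 * B)) ^ (n - p + 1) :=
          mul_le_mul_of_nonneg_left hpow (by linarith)
        _ = _ := by rw [pow_succ]; field_simp
    have h4 := le_of_mul_le_mul_right h3 (by positivity)
    linarith

end Nash

/-! ### The exchange argument -/

section Greedy

variable {n : ℕ} {P : (Fin n → ℕ) → Prop} {c m : ℕ} {x z u₀ : Fin n → ℕ}
  {U : Finset (Fin n)}

/-- Agent `i` holding `y i` goods of value `c` and `w i` goods of value `1` gives utilities that
are at least as good as `u₀`, and the vectors `y`, `w` extend `x`, `z`. Here `y` has to satisfy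
`P`, and at most `m` goods are used. -/
def CanMatch (P : (Fin n → ℕ) → Prop) (c m : ℕ) (u₀ x z : Fin n → ℕ) : Prop :=
  ∃ y w, P y ∧ x ≤ y ∧ z ≤ w ∧ ∑ i, y i + ∑ i, w i ≤ m ∧ NashLE u₀ fun i => c * y i + w i

lemma exists_eq_add_single {w : Fin n → ℕ} {i : Fin n} {d : ℕ} (h : d ≤ w i) :
    ∃ w₀ : Fin n → ℕ, w = w₀ + Pi.single i d := by
  refine ⟨fun k => if k = i then w k - d else w k, ?_⟩
  funext k
  by_cases hk : k = i
  · subst hk; simp [Nat.sub_add_cancel h]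
  · simp [hk]

lemma sum_add_single (w : Fin n → ℕ) (i : Fin n) (d : ℕ) :
    ∑ k, (w + Pi.single i d : Fin n → ℕ) k = ∑ k, w k + d := by
  simp [Finset.sum_add_distrib]

/-- Moving one good of value `c` from `j` to `l`, where `l` had no more such goods than `j`
keeps. If this raises `l` above the old utility of `j`, then goods of value `1` compensate. -/
lemma CanMatch.move (hc : 1 ≤ c) {y₀ w : Fin n → ℕ} {l j : Fin n} (hjl : j ≠ l)
    (hP : P (y₀ + Pi.single l 1)) (hx : x + Pi.single l 1 ≤ y₀ + Pi.single l 1) (hz : z ≤ w)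
    (hzl : z l = 0) (hzj : z j = 0) (hlj : y₀ l ≤ y₀ j)
    (hsum : ∑ i, (y₀ + Pi.single j 1 : Fin n → ℕ) i + ∑ i, w i ≤ m)
    (hu : NashLE u₀ fun i => c * (y₀ + Pi.single j 1 : Fin n → ℕ) i + w i) :
    CanMatch P c m u₀ (x + Pi.single l 1) z := by
  rw [sum_add_single] at hsum
  by_cases h1 : c ≤ w l
  · -- The utilities stay the same if `l` returns `c` goods of value `1`.
    obtain ⟨w₀, rfl⟩ := exists_eq_add_single h1
    refine ⟨_, w₀ + Pi.single j c, hP, hx, ?_, ?_, hu.trans (NashLE.of_le ?_)⟩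
    · intro k
      have := hz k
      by_cases hk : k = l
      · subst hk; rw [hzl]; exact Nat.zero_le _
      · simp only [Pi.add_apply, Pi.single_apply, if_neg hk] at this ⊢
        omega
    · rw [sum_add_single] at hsum
      rw [sum_add_single, sum_add_single]
      exact hsum
    · intro k
      by_cases hk : k = l
      · subst hk
        simp [hjl.symm, mul_add]
        omega
      · by_cases hk' : k = j
        · subst hk'
          simp [hjl, mul_add]
          omega
        · simp [hk, hk']
  by_cases h2 : c * y₀ l + w l ≤ c * y₀ j + w j
  · refine ⟨_, w, hP, hx, hz, by rwa [sum_add_single], hu.trans (NashLE.of_pair hjl ?_ ?_)⟩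
    · intro i hil hij
      simp [hil, hij]
    · intro ε h0 h1
      have := smoothed_mul_le_gain_lose hc h2 h1
      convert this using 3
      · simp [hjl.symm]
      · simp; ring
      · simp; ring
      · simp [hjl]
  · -- Otherwise `l` and `j` can exchange their utilities.
    have heq : y₀ l = y₀ j := by
      by_contra hne
      have h3 : y₀ l + 1 ≤ y₀ j := by omega
      have h4 := Nat.mul_le_mul_left c h3
      rw [mul_add] at h4
      omega
    refine ⟨_, fun i => w (Equiv.swap l j i), hP, hx, ?_, ?_,
      hu.trans (NashLE.of_perm (Equiv.swap l j) ?_)⟩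
    · intro k
      by_cases hk : k = l
      · subst hk; rw [hzl]; exact Nat.zero_le _
      · by_cases hk' : k = j
        · subst hk'; rw [hzj]; exact Nat.zero_le _
        · simpa [Equiv.swap_apply_of_ne_of_ne hk hk'] using hz k
    · rw [sum_add_single, Equiv.sum_comp (Equiv.swap l j) w]
      exact hsum
    · intro k
      by_cases hk : k = l
      · subst hk; simp [heq]
      · by_cases hk' : k = j
        · subst hk'; simp [hjl, hjl.symm, heq]
        · simp [Equiv.swap_apply_of_ne_of_ne hk hk', hk, hk']

/-- The invariant survives giving a good of value `c` to an agent `l` in play. -/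
lemma CanMatch.transfer (hc : 1 ≤ c) (hdown : ∀ y j, P (y + Pi.single j 1) → P y) {l : Fin n}
    (hl : l ∈ U)
    (hexch : ∀ y, P y → y l = x l → P (y + Pi.single l 1) ∨ ∃ (j : Fin n) (y₀ : Fin n → ℕ),
      j ≠ l ∧ x j < y j ∧ y = y₀ + Pi.single j 1 ∧ P (y₀ + Pi.single l 1))
    (htight : ∀ y, P y → x ≤ y → ∀ j ∉ U, y j = x j) (hzU : ∀ j ∈ U, z j = 0)
    (hin : ∀ j ∈ U, x l ≤ x j) (hout : ∀ j ∉ U, x l ≤ c * x j + z j)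
    (hlt : ∑ i, x i + ∑ i, z i < m) (h : CanMatch P c m u₀ x z) :
    CanMatch P c m u₀ (x + Pi.single l 1) z := by
  obtain ⟨y, w, hP, hxy, hzw, hsum, hu⟩ := h
  by_cases hyl : x l < y l
  · refine ⟨y, w, hP, fun k => ?_, hzw, hsum, hu⟩
    by_cases hk : k = l
    · subst hk; simpa using hyl
    · simpa [hk] using hxy k
  have hyl : y l = x l := le_antisymm (not_lt.1 hyl) (hxy l)
  have move : ∀ (j : Fin n) (y₀ : Fin n → ℕ), j ≠ l → x j < y j → y = y₀ + Pi.single j 1 →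
      P (y₀ + Pi.single l 1) → CanMatch P c m u₀ (x + Pi.single l 1) z := by
    rintro j y₀ hjl hj rfl hP'
    have hjU : j ∈ U := by
      by_contra hjU
      exact hj.ne' (htight _ hP hxy j hjU)
    have hyl' : y₀ l = x l := by simpa [hjl.symm] using hyl
    have hj' : x j ≤ y₀ j := by simpa [Nat.lt_succ_iff] using hj
    have hx : x ≤ y₀ := by
      intro k
      by_cases hk : k = j
      · subst hk; exact hj'
      · simpa [hk] using hxy k
    exact CanMatch.move hc hjl hP' (add_le_add_left hx _) hzw (hzU l hl) (hzU j hjU)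
      (hyl'.le.trans ((hin j hjU).trans hj')) hsum hu
  rcases hexch y hP hyl with hP' | ⟨j, y₀, hjl, hj, hy, hP'⟩
  swap
  · exact move j y₀ hjl hj hy hP'
  have hx' : x + Pi.single l 1 ≤ y + Pi.single l 1 := add_le_add_left hxy _
  by_cases hm : ∑ i, y i + ∑ i, w i < m
  · refine ⟨_, w, hP', hx', hzw, ?_, hu.trans (NashLE.of_le fun k => ?_)⟩
    · rw [sum_add_single]; omega
    · simp [mul_add]
  by_cases hw : ∃ k, z k < w k
  · -- Some agent gives up a good of value `1`, if possible `l`.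
    obtain ⟨k, hk, hkl⟩ : ∃ k, z k < w k ∧ (k ≠ l → w l = 0) := by
      by_cases hwl : w l = 0
      · obtain ⟨k, hk⟩ := hw
        exact ⟨k, hk, fun _ => hwl⟩
      · exact ⟨l, by rw [hzU l hl]; omega, fun h => (h rfl).elim⟩
    obtain ⟨w₀, rfl⟩ := exists_eq_add_single (Nat.one_le_of_lt hk)
    have hk' : z k ≤ w₀ k := by simpa [Nat.lt_succ_iff] using hk
    refine ⟨_, w₀, hP', hx', ?_, ?_, hu.trans ?_⟩
    · intro i
      by_cases hi : i = k
      · subst hi; exact hk'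
      · simpa [hi] using hzw i
    · rw [sum_add_single] at hsum ⊢
      omega
    by_cases hkl' : k = l
    · subst hkl'
      refine NashLE.of_le fun i => ?_
      by_cases hi : i = k
      · subst hi
        simp [mul_add]
        omega
      · simp [hi]
    · have hwl : w₀ l = 0 := by simpa [Ne.symm hkl'] using hkl hkl'
      have hle : x l ≤ c * y k + w₀ k := by
        have h1 := Nat.mul_le_mul_left c (hxy k)
        by_cases hkU : k ∈ U
        · have := hin k hkU
          have := Nat.le_mul_of_pos_left (x k) hc
          omega
        · have := hout k hkU
          omega
      refine NashLE.of_pair hkl' ?_ ?_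
      · intro i hil hik
        simp [hil, hik]
      · intro ε h0 h1
        have := smoothed_mul_le_gain_lose_one (a := c * y l) hc
          (Nat.mul_le_mul_left c (hyl.le.trans hle)) h0 h1
        convert this using 3
        · simp [hwl, Ne.symm hkl']
        · simp; ring
        · simp [hwl]; ring
        · simp [hkl']
  · -- Otherwise some agent has more goods of value `c` than required.
    have hwz : w = z := le_antisymm (fun k => not_lt.1 fun hk => hw ⟨k, hk⟩) hzw
    subst hwz
    obtain ⟨j, hj⟩ : ∃ j, x j < y j := by
      by_contra! hcon
      have : ∑ i, y i ≤ ∑ i, x i := Finset.sum_le_sum fun i _ => hcon i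
      omega
    have hjl : j ≠ l := by rintro rfl; omega
    obtain ⟨y₀, rfl⟩ := exists_eq_add_single (Nat.one_le_of_lt hj)
    exact move j y₀ hjl hj rfl (hdown _ j (by rwa [add_right_comm]))

/-- The invariant survives giving a good of value `1` to an agent `i` no longer in play. -/
lemma CanMatch.provisional (hc : 1 ≤ c) (hdown : ∀ y j, P (y + Pi.single j 1) → P y)
    {i : Fin n} (hi : i ∉ U)
    (htight : ∀ y, P y → x ≤ y → ∀ j ∉ U, y j = x j)
    (hin : ∀ j ∈ U, c * x i + z i < x j) (hout : ∀ j ∉ U, c * x i + z i ≤ c * x j + z j)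
    (hlt : ∑ k, x k + ∑ k, z k < m) (h : CanMatch P c m u₀ x z) :
    CanMatch P c m u₀ x (z + Pi.single i 1) := by
  obtain ⟨y, w, hP, hxy, hzw, hsum, hu⟩ := h
  by_cases hwi : z i < w i
  · refine ⟨y, w, hP, hxy, fun k => ?_, hsum, hu⟩
    by_cases hk : k = i
    · subst hk; simpa using hwi
    · simpa [hk] using hzw k
  have hwi : w i = z i := le_antisymm (not_lt.1 hwi) (hzw i)
  have hyi : y i = x i := htight y hP hxy i hi
  by_cases hm : ∑ k, y k + ∑ k, w k < m
  · refine ⟨y, w + Pi.single i 1, hP, hxy, add_le_add_left hzw _, ?_,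
      hu.trans (NashLE.of_le fun k => ?_)⟩
    · rw [sum_add_single]; omega
    · simp
  by_cases hw : ∃ k, z k < w k
  · obtain ⟨k, hk⟩ := hw
    have hki : k ≠ i := by rintro rfl; omega
    obtain ⟨w₀, rfl⟩ := exists_eq_add_single (Nat.one_le_of_lt hk)
    have hk' : z k ≤ w₀ k := by simpa [Nat.lt_succ_iff] using hk
    have hw₀i : w₀ i = z i := by simpa [hki.symm] using hwi
    refine ⟨y, w₀ + Pi.single i 1, hP, hxy, add_le_add_left (fun j => ?_) _, ?_,
      hu.trans (NashLE.of_pair hki ?_ ?_)⟩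
    · by_cases hj : j = k
      · subst hj; exact hk'
      · simpa [hj] using hzw j
    · rw [sum_add_single] at hsum ⊢
      exact hsum
    · intro j hji hjk
      simp [hji, hjk]
    · intro ε h0 h1
      have hle : c * y i + w₀ i ≤ 1 * (c * y k + w₀ k) := by
        rw [hyi, hw₀i, one_mul]
        have h2 := Nat.mul_le_mul_left c (hxy k)
        by_cases hkU : k ∈ U
        · have := hin k hkU
          have := Nat.le_mul_of_pos_left (x k) hc
          omega
        · have := hout k hkU
          omega
      have := smoothed_mul_le_gain_lose_one le_rfl hle h0 h1
      convert this using 3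
      · simp [hki.symm]
      · simp; ring
      · simp; ring
      · simp [hki]
  · have hwz : w = z := le_antisymm (fun k => not_lt.1 fun hk => hw ⟨k, hk⟩) hzw
    subst hwz
    obtain ⟨k, hk⟩ : ∃ k, x k < y k := by
      by_contra! hcon
      have : ∑ j, y j ≤ ∑ j, x j := Finset.sum_le_sum fun j _ => hcon j
      omega
    have hki : k ≠ i := by rintro rfl; omega
    have hkU : k ∈ U := by
      by_contra hkU
      exact hk.ne' (htight _ hP hxy k hkU)
    obtain ⟨y₀, rfl⟩ := exists_eq_add_single (Nat.one_le_of_lt hk)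
    have hk' : x k ≤ y₀ k := by simpa [Nat.lt_succ_iff] using hk
    have hy₀i : y₀ i = x i := by simpa [hki.symm] using hyi
    have hbase := hin k hkU
    refine ⟨y₀, w + Pi.single i 1, hdown _ _ hP, fun j => ?_, le_rfl, ?_,
      hu.trans (NashLE.of_pair hki ?_ ?_)⟩
    · by_cases hj : j = k
      · subst hj; exact hk'
      · simpa [hj] using hxy j
    · rw [sum_add_single] at hsum ⊢
      omega
    · intro j hji hjk
      simp [hji, hjk]
    · intro ε h0 h1
      have h2 : c * (c * y₀ i + w i + 1) ≤ c * y₀ k + w k := by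
        have := Nat.mul_le_mul_left c (by rw [hy₀i]; omega : c * y₀ i + w i + 1 ≤ y₀ k)
        omega
      rw [mul_add, mul_one] at h2
      have := smoothed_mul_le_gain_one_lose (c := c) (a := c * y₀ i + w i)
        (b := c * y₀ k + w k) (by omega) (by omega) (by omega) h1
      convert this using 3
      · simp [hki.symm]
      · simp; ring
      · simp; ring
      · simp [hki]

/-- If all goods have been used, then the extension is trivial. -/
lemma CanMatch.nashLE (hsum : ∑ k, x k + ∑ k, z k = m) (h : CanMatch P c m u₀ x z) :
    NashLE u₀ fun i => c * x i + z i := by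
  obtain ⟨y, w, -, hxy, hzw, hle, hu⟩ := h
  refine hu.trans (NashLE.of_le fun i => ?_)
  have h1 : ∑ k, x k ≤ ∑ k, y k := Finset.sum_le_sum fun k _ => hxy k
  have h2 : ∑ k, z k ≤ ∑ k, w k := Finset.sum_le_sum fun k _ => hzw k
  have h3 := (Finset.sum_eq_sum_iff_of_le fun k _ => hxy k).1 (by omega) i (Finset.mem_univ i)
  have h4 := (Finset.sum_eq_sum_iff_of_le fun k _ => hzw k).1 (by omega) i (Finset.mem_univ i)
  simp only [h3, h4]
  exact le_rfl

end Greedy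

/-! ### The gain function -/

section Phi

variable {n : ℕ} {M : ℝ} {u : Fin n → ℝ} {i k : Fin n} {a b d e x : ℕ}

lemma le_of_phiMNW_le (hM : 3 ≤ M) (hd : 1 ≤ d) (he : 1 ≤ e) (hi : u i = (d * x : ℕ))
    (hk : u k = b) (h : phiMNW M u k e ≤ phiMNW M u i d) : e * x ≤ b := by
  rcases Nat.eq_zero_or_pos x with rfl | hx
  · simp
  have hd' : (1 : ℝ) ≤ d := by exact_mod_cast hd
  have he' : (1 : ℝ) ≤ e := by exact_mod_cast he
  have hx' : (1 : ℝ) ≤ x := by exact_mod_cast hx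
  have hi' : phiMNW M u i d = 1 + 1 / x := by
    rw [phiMNW, hi, if_pos (by exact_mod_cast Nat.mul_pos hd hx)]
    push_cast
    field_simp
  have hx1 : (1 : ℝ) / x ≤ 1 := (div_le_one (by linarith)).2 hx'
  rw [hi', phiMNW, hk] at h
  by_cases hb : (0 : ℝ) < b
  · rw [if_pos hb, add_div, div_self hb.ne', add_le_add_iff_left,
      div_le_div_iff₀ hb (by linarith), one_mul] at h
    exact_mod_cast h
  · rw [if_neg hb] at h
    nlinarith

lemma lt_of_phiMNW_lt (hM : 3 ≤ M) (hd : 1 ≤ d) (hi : u i = a) (hk : u k = (d * x : ℕ))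
    (h : phiMNW M u k d < phiMNW M u i 1) : a < x := by
  have hd' : (1 : ℝ) ≤ d := by exact_mod_cast hd
  have hi' : phiMNW M u i 1 ≤ M := by
    rw [phiMNW, hi]
    split_ifs with ha
    · have : (1 : ℝ) ≤ a := by exact_mod_cast (Nat.cast_pos.1 ha : 0 < a)
      rw [div_le_iff₀ ha]
      nlinarith
    · simp
  rcases Nat.eq_zero_or_pos x with rfl | hx
  · have hk' : phiMNW M u k d = M * d := by simp [phiMNW, hk]
    rw [hk'] at h
    nlinarith
  have hx' : (0 : ℝ) < x := by exact_mod_cast hx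
  have hk' : phiMNW M u k d = 1 + 1 / x := by
    rw [phiMNW, hk, if_pos (by exact_mod_cast Nat.mul_pos hd hx)]
    push_cast
    field_simp
  rcases Nat.eq_zero_or_pos a with rfl | ha
  · exact hx
  have ha' : (0 : ℝ) < a := by exact_mod_cast ha
  rw [hk', phiMNW, hi, if_pos ha', add_div, div_self ha'.ne', add_lt_add_iff_left,
    div_lt_div_iff₀ hx' ha', one_mul, one_mul] at h
  exact_mod_cast h

variable {G : Type*} [Fintype G] {v : Fin n → Finset G → ℝ}
  {φ : (Fin n → ℝ) → Fin n → ℝ → ℝ} {s : State n G} {A : Finset (Fin n)} {α : ℝ}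

lemma State.Chooses.gain_eq (h : s.Chooses v φ A α i) :
    s.gain v φ A α = (φ (utility v s.union) i α : ℝ) :=
  le_antisymm (Finset.sup_le fun k hk => WithBot.coe_le_coe.2 (h.1.2 k hk))
    (Finset.le_sup (f := fun k => ((φ (utility v s.union) k α : ℝ) : WithBot ℝ)) h.1.1)

lemma State.le_gain (hk : k ∈ A) : (φ (utility v s.union) k α : WithBot ℝ) ≤ s.gain v φ A α :=
  Finset.le_sup (f := fun k => ((φ (utility v s.union) k α : ℝ) : WithBot ℝ)) hk

lemma State.exists_chooses (hA : A.Nonempty) : ∃ i, s.Chooses v φ A α i := by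
  obtain ⟨j, hjA, hj⟩ := A.exists_max_image (fun k => φ (utility v s.union) k α) hA
  obtain ⟨i, hi, hmin⟩ := WellFounded.has_min (wellFounded_lt (α := Fin n))
    {j | j ∈ A ∧ ∀ k ∈ A, φ (utility v s.union) k α ≤ φ (utility v s.union) j α} ⟨j, hjA, hj⟩
  exact ⟨i, hi, fun k hk => not_lt.1 (hmin k hk)⟩

end Phi

/-! ### The invariant of the algorithm -/

section ValRank

variable {n : ℕ} {G : Type*} [DecidableEq G] {c : ℕ} {v : Fin n → Finset G → ℝ}

/-- The functions `β_j`, which are the rank functions of matroids. -/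
noncomputable def valRank (c : ℕ) (v : Fin n → Finset G → ℝ) (j : Option (Fin n)) :
    Finset G → ℕ :=
  beta (c : ℝ) (extValuation (c : ℝ) v j)

lemma valRank_none (hc : 2 ≤ c) : valRank c v none = (Finset.card : Finset G → ℕ) := by
  funext S
  refine beta_eq_rank hc isRank_card (fun T => ?_) S
  simp only [extValuation]
  ring

lemma valRank_spec (hc : 2 ≤ c) (hv : ∀ i, IsBivaluedSubmodular 1 (c : ℝ) (v i)) (i : Fin n) :
    IsRank (valRank c v (some i)) ∧
      ∀ S, v i S = S.card + ((c : ℝ) - 1) * valRank c v (some i) S := by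
  obtain ⟨r, hr, hvr⟩ := (hv i).exists_isRank hc
  have : valRank c v (some i) = r := funext (beta_eq_rank hc hr hvr)
  rw [this]
  exact ⟨hr, hvr⟩

lemma isRank_valRank (hc : 2 ≤ c) (hv : ∀ i, IsBivaluedSubmodular 1 (c : ℝ) (v i))
    (j : Option (Fin n)) : IsRank (valRank c v j) := by
  cases j with
  | none => rw [valRank_none hc]; exact isRank_card
  | some i => exact (valRank_spec hc hv i).1

end ValRank

section Algorithm

variable {n : ℕ} {G : Type*} [Fintype G] {c : ℕ} {v : Fin n → Finset G → ℝ}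

/-- The numbers of goods of the agents. -/
def sizes (X : Allocation n G) (i : Fin n) : ℕ := (bundle X (some i)).card

/-- The utilities of the agents as natural numbers: each of the `r` goods of a basis of the
bundle is worth `c`, and each of the other goods is worth `1`. -/
noncomputable def natUtility (c : ℕ) (v : Fin n → Finset G → ℝ) (X : Allocation n G)
    (i : Fin n) : ℕ :=
  c * valRank c v (some i) (bundle X (some i)) +
    (sizes X i - valRank c v (some i) (bundle X (some i)))

/-- The invariant of Bivalued Yankee Swap. Agents that have left `U` lie in tight sets, and
every allocation can be matched in Nash welfare by an extension of the current allocation. -/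
structure Invariant (c : ℕ) (v : Fin n → Finset G → ℝ) (s : State n G) : Prop where
  clean : IsClean (valRank c v) s.high
  high_eq_none : ∀ g, s.low g ≠ none → s.high g = none
  low_ne : ∀ g, ∀ i ∈ s.inPlay, s.low g ≠ some i
  tight : ∀ i ∉ s.inPlay, ∃ A, i ∈ A ∧ IsTight (valRank c v) s.high A
  canMatch : ∀ Y, CanMatch (Feasible (valRank c v)) c (Fintype.card G) (natUtility c v Y)
    (sizes s.high) (sizes s.low)

namespace Invariant

variable {s : State n G} {i : Fin n}

lemma running_iff (s : State n G) :
    s.Running ↔ ∑ i, sizes s.high i + ∑ i, sizes s.low i < Fintype.card G := by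
  have h1 := sum_card_bundle s.high
  simp only [State.Running, sizes]
  omega

lemma exists_isFree (hs : s.Running) : ∃ g, s.IsFree g := by
  by_contra! hcon
  rw [running_iff, ← sum_card_bundle s.low] at hs
  have h1 := sum_card_bundle s.high
  have h2 := sum_card_bundle s.low
  have h3 : (bundle s.high none).card ≤ (Finset.univ.filter fun g => s.low g ≠ none).card := by
    refine Finset.card_le_card fun g hg => ?_
    simpa using fun h => hcon g ⟨mem_bundle.1 hg, h⟩
  have h4 := Finset.card_filter_add_card_filter_not (s := Finset.univ) fun g => s.low g = none
  rw [Finset.card_univ] at h4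
  have h5 : (bundle s.low none).card = (Finset.univ.filter fun g => s.low g = none).card := rfl
  simp only [sizes] at hs
  simp only [ne_eq] at h3
  omega

lemma sizes_low_eq_zero (h : Invariant c v s) (hi : i ∈ s.inPlay) : sizes s.low i = 0 :=
  Finset.card_eq_zero.2 (Finset.eq_empty_of_forall_notMem fun g hg =>
    h.low_ne g i hi (mem_bundle.1 hg))

/-- A tight set stays at its maximum, so no extension gives more goods of value `c` to an agent
no longer in play. -/
lemma eq_of_notMem (h : Invariant c v s) {y : Fin n → ℕ} (hy : Feasible (valRank c v) y)
    (hle : sizes s.high ≤ y) (hi : i ∉ s.inPlay) : y i = sizes s.high i := by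
  obtain ⟨A, hiA, hA⟩ := h.tight i hi
  obtain ⟨Y, hY, hYy⟩ := hy
  have h1 := hA Y hY
  simp only [hYy] at h1
  exact ((Finset.sum_eq_sum_iff_of_le fun j _ => hle j).1
    (le_antisymm (Finset.sum_le_sum fun j _ => hle j) h1) i hiA).symm

end Invariant

variable [DecidableEq G]

lemma utility_eq (hc : 2 ≤ c) (hv : ∀ i, IsBivaluedSubmodular 1 (c : ℝ) (v i))
    (X : Allocation n G) (i : Fin n) : utility v X i = natUtility c v X i := by
  have h := (valRank_spec hc hv i).1.le_card (bundle X (some i))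
  rw [utility, (valRank_spec hc hv i).2, natUtility, sizes]
  push_cast [Nat.cast_sub h]
  ring

lemma isTransferPath_iff {X : Allocation n G} {i : Fin n} {p : List G} :
    IsTransferPath (c : ℝ) v X i p ↔ IsPath (RankEdge (valRank c v) X)
      (RankGain (valRank c v) X (some i)) (fun g => X g = none) p :=
  Iff.rfl

lemma IsShortestTransferPath.chordless {X : Allocation n G} {i : Fin n} {p : List G}
    (h : IsShortestTransferPath (c : ℝ) v X i p) : Chordless (RankEdge (valRank c v) X)
      (fun g => X g = none) (RankGain (valRank c v) X (some i)) p :=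
  (isTransferPath_iff.1 h.1).chordless_of_shortest fun q hq => h.2 q (isTransferPath_iff.2 hq)

lemma IsTight.notMem_of_chordless {r : Option (Fin n) → Finset G → ℕ} (hr : ∀ k, IsRank (r k))
    {X : Allocation n G} (hX : IsClean r X) {A : Finset (Fin n)} (hA : IsTight r X A)
    {i : Fin n} {p : List G}
    (hp : Chordless (RankEdge r X) (fun g => X g = none) (RankGain r X (some i)) p) : i ∉ A := by
  intro hi
  obtain ⟨h1, h2, -⟩ := hp.augment hr hX (by simp)
  refine absurd (hA _ h1) (not_le.2 (Finset.sum_lt_sum (fun j _ => ?_) ⟨i, hi, ?_⟩))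
  · rw [h2 (some j) (by simp)]
    omega
  · rw [h2 (some i) (by simp), if_pos rfl]
    omega

namespace Invariant

variable {s : State n G} {i : Fin n}

lemma sum_add_sum_le (h : Invariant c v s) :
    ∑ i, sizes s.high i + ∑ i, sizes s.low i ≤ Fintype.card G := by
  have h1 := sum_card_bundle s.high
  have h2 : ∑ i : Fin n, (bundle s.low (some i)).card ≤ (bundle s.high none).card := by
    rw [← Finset.card_biUnion]
    · refine Finset.card_le_card fun g hg => ?_
      obtain ⟨i, -, hi⟩ := Finset.mem_biUnion.1 hg
      exact mem_bundle.2 (h.high_eq_none g (by rw [mem_bundle.1 hi]; simp))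
    · intro a _ b _ hab
      refine Finset.disjoint_left.2 fun g hga hgb => hab ?_
      exact Option.some.inj ((mem_bundle.1 hga).symm.trans (mem_bundle.1 hgb))
  simp only [sizes]
  omega

lemma natUtility_union (hr : ∀ k, IsRank (valRank c v k)) (h : Invariant c v s) (i : Fin n) :
    natUtility c v s.union i = c * sizes s.high i + sizes s.low i := by
  have hb : bundle s.union (some i) = bundle s.high (some i) ∪ bundle s.low (some i) := by
    ext g
    simp only [mem_bundle, Finset.mem_union, State.union]
    by_cases hg : s.low g = none
    · simp [hg]
    · simp [h.high_eq_none g hg]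
  have hd : Disjoint (bundle s.high (some i)) (bundle s.low (some i)) := by
    refine Finset.disjoint_left.2 fun g h1 h2 => ?_
    rw [mem_bundle] at h1 h2
    have := h.high_eq_none g (by simp [h2])
    simp [this] at h1
  have hrank : valRank c v (some i) (bundle s.union (some i)) = sizes s.high i := by
    rw [hb, sizes, ← h.clean (some i)]
    refine (hr (some i)).union_eq_of_forall_insert_eq fun g hg => ?_
    rw [mem_bundle] at hg
    have hiU : i ∉ s.inPlay := fun hi => h.low_ne g i hi hg
    obtain ⟨A, hiA, hA⟩ := h.tight i hiU
    have hn : s.high g = none := h.high_eq_none g (by simp [hg])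
    have hgain : ¬ RankGain (valRank c v) s.high (some i) g := fun hgain =>
      hA.notMem_of_chordless hr h.clean (p := [g]) ⟨hgain, hn⟩ hiA
    have h1 := (hr (some i)).le_insert (bundle s.high (some i)) g
    have h2 := (hr (some i)).insert_le (bundle s.high (some i)) g
    rw [RankGain] at hgain
    omega
  have hcard : sizes s.union i = sizes s.high i + sizes s.low i := by
    rw [sizes, hb, Finset.card_union_of_disjoint hd]
    rfl
  rw [natUtility, hrank, hcard]
  omega

lemma utility_union (hc : 2 ≤ c) (hv : ∀ i, IsBivaluedSubmodular 1 (c : ℝ) (v i))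
    (h : Invariant c v s) (i : Fin n) :
    utility v s.union i = (c * sizes s.high i + sizes s.low i : ℕ) := by
  rw [utility_eq hc hv, h.natUtility_union (isRank_valRank hc hv)]

lemma init (hc : 2 ≤ c) (hr : ∀ k, IsRank (valRank c v k)) :
    Invariant c v (State.init n G) where
  clean := by
    rintro (_ | i)
    · rw [valRank_none hc]
    · have : bundle (State.init n G).high (some i) = ∅ := by simp [bundle, State.init]
      rw [this, (hr _).empty, Finset.card_empty]
  high_eq_none _ _ := rfl
  low_ne _ _ _ := by simp [State.init]
  tight i hi := (hi (Finset.mem_univ i)).elim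
  canMatch Y := by
    have h0 : ∀ i, sizes (fun _ => none : Allocation n G) i = 0 := fun i => by
      simp [sizes, bundle]
    refine ⟨fun i => valRank c v (some i) (bundle Y (some i)),
      fun i => sizes Y i - valRank c v (some i) (bundle Y (some i)),
      feasible_rank hr (valRank_none hc) Y, fun i => (h0 i).le.trans (Nat.zero_le _),
      fun i => (h0 i).le.trans (Nat.zero_le _), ?_, NashLE.refl _⟩
    rw [← Finset.sum_add_distrib]
    have h1 := sum_card_bundle Y
    have h2 : ∀ i : Fin n, valRank c v (some i) (bundle Y (some i)) +
        (sizes Y i - valRank c v (some i) (bundle Y (some i))) = (bundle Y (some i)).card :=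
      fun i => Nat.add_sub_cancel' ((hr _).le_card _)
    simp only [h2]
    omega

lemma sizes_augment (hr : ∀ k, IsRank (valRank c v k)) (h : Invariant c v s) {p : List G}
    (hp : IsShortestTransferPath (c : ℝ) v s.high i p) :
    sizes (augment s.high (some i) p) = sizes s.high + Pi.single i 1 := by
  funext k
  rw [sizes, (hp.chordless.augment hr h.clean (by simp)).2.1 (some k) (by simp)]
  simp [sizes, Pi.single_apply]

/-- The invariant is preserved when `i` receives a good along a shortest path and the
provisional goods are rearranged to avoid the last good `t` of the path. -/
lemma transfer (hc : 2 ≤ c) (hv : ∀ i, IsBivaluedSubmodular 1 (c : ℝ) (v i)) {M : ℝ}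
    (hM : 3 ≤ M) (h : Invariant c v s) {p : List G} {t : G} {low : Allocation n G}
    (running : s.Running)
    (gain : s.gain v (phiMNW M) s.inPlayᶜ 1 ≤ s.gain v (phiMNW M) s.inPlay c)
    (chosen : s.Chooses v (phiMNW M) s.inPlay c i)
    (path : IsShortestTransferPath (c : ℝ) v s.high i p) (last : t ∈ p.getLast?)
    (hsizes : sizes low = sizes s.low)
    (hlow : ∀ g, low g ≠ none → s.high g = none ∧ g ≠ t)
    (hplay : ∀ g, ∀ j ∈ s.inPlay, low g ≠ some j) :
    Invariant c v ⟨augment s.high (some i) p, low, s.inPlay⟩ := by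
  have hr := isRank_valRank hc hv
  have hp := path.chordless
  obtain ⟨h1, h2, h3⟩ := hp.augment hr h.clean (by simp)
  obtain ⟨-, h3⟩ := h3 t last
  have hu := h.utility_union hc hv
  have huU : ∀ k ∈ s.inPlay, utility v s.union k = (c * sizes s.high k : ℕ) := fun k hk => by
    rw [hu, h.sizes_low_eq_zero hk, add_zero]
  refine ⟨h1, ?_, hplay, ?_, ?_⟩
  · intro g hg
    obtain ⟨h4, h5⟩ := hlow g hg
    have : g ∈ bundle (augment s.high (some i) p) none := by
      rw [h3]
      exact Finset.mem_erase.2 ⟨h5, mem_bundle.2 h4⟩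
    exact mem_bundle.1 this
  · intro j hj
    obtain ⟨A, hjA, hA⟩ := h.tight j hj
    have hiA := hA.notMem_of_chordless hr h.clean hp
    refine ⟨A, hjA, fun Y hY => (hA Y hY).trans (Finset.sum_le_sum fun k _ => ?_)⟩
    change _ ≤ (bundle (augment s.high (some i) p) (some k)).card
    rw [h2 (some k) (by simp)]
    omega
  · intro Y
    simp only [h.sizes_augment hr path, hsizes]
    refine (h.canMatch Y).transfer (U := s.inPlay) (by omega)
      (fun y j hy => hy.of_add_single hr (valRank_none hc)) chosen.1.1 ?_
      (fun y hy hle j hj => h.eq_of_notMem hy hle hj) (fun j hj => h.sizes_low_eq_zero hj)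
      ?_ ?_ ((running_iff s).1 running)
    · intro y hy hyi
      have hx : Feasible (valRank c v) (sizes s.high + Pi.single i 1) :=
        ⟨_, h1, fun k => congrFun (h.sizes_augment hr path) k⟩
      refine (hx.exchange hr hy (by simp [hyi])).imp_right ?_
      rintro ⟨j, y₀, hji, hj, hy₀, hP⟩
      exact ⟨j, y₀, hji, by simpa [hji] using hj, hy₀, hP⟩
    · intro j hj
      have := le_of_phiMNW_le hM (by omega) (by omega) (huU i chosen.1.1) (huU j hj)
        (chosen.1.2 j hj)
      exact Nat.le_of_mul_le_mul_left this (by omega)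
    · intro j hj
      have h4 : phiMNW M (utility v s.union) j 1 ≤ phiMNW M (utility v s.union) i c := by
        have := (State.le_gain (Finset.mem_compl.2 hj)).trans gain
        rw [chosen.gain_eq] at this
        exact WithBot.coe_le_coe.1 this
      have := le_of_phiMNW_le (e := 1) hM (by omega) le_rfl (huU i chosen.1.1) (hu j)
        (by simpa using h4)
      simpa using this

lemma leave (hr : ∀ k, IsRank (valRank c v k)) (h : Invariant c v s)
    (no_path : ¬ ∃ p, IsTransferPath (c : ℝ) v s.high i p) :
    Invariant c v ⟨s.high, s.low, s.inPlay.erase i⟩ := by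
  refine ⟨h.clean, h.high_eq_none, fun g j hj => h.low_ne g j (Finset.mem_of_mem_erase hj), ?_,
    h.canMatch⟩
  intro j hj
  by_cases hji : j = i
  · subst hji
    obtain ⟨A, hA, -, hA'⟩ := exists_isTight_of_forall_reachable hr h.clean (i := j) <| by
      rintro g ⟨a, ha, hag⟩ hg
      obtain ⟨p, hp⟩ := exists_isPath_of_reflTransGen (T := fun g => s.high g = none) ha hag hg
      exact no_path ⟨p, isTransferPath_iff.2 hp⟩
    exact ⟨A, hA, hA'⟩
  · exact h.tight j fun hj' => hj (Finset.mem_erase.2 ⟨hji, hj'⟩)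

lemma sizes_update {X : Allocation n G} {g : G} (hg : X g = none) :
    sizes (Function.update X g (some i)) = sizes X + Pi.single i 1 := by
  funext k
  by_cases hk : k = i
  · subst hk
    rw [sizes, bundle_update_self, Finset.card_insert_of_notMem (by simp [mem_bundle, hg])]
    simp [sizes]
  · rw [sizes, bundle_update_of_ne_of_ne (by simpa using Ne.symm hk) (by simp [hg])]
    simp [sizes, hk]

lemma provisional (hc : 2 ≤ c) (hv : ∀ i, IsBivaluedSubmodular 1 (c : ℝ) (v i)) {M : ℝ}
    (hM : 3 ≤ M) (h : Invariant c v s) {g : G} (running : s.Running)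
    (gain : s.gain v (phiMNW M) s.inPlay c < s.gain v (phiMNW M) s.inPlayᶜ 1)
    (chosen : s.Chooses v (phiMNW M) s.inPlayᶜ 1 i) (free : s.IsFree g) :
    Invariant c v ⟨s.high, Function.update s.low g (some i), s.inPlay⟩ := by
  have hr := isRank_valRank hc hv
  have hi : i ∉ s.inPlay := Finset.mem_compl.1 chosen.1.1
  have hu := h.utility_union hc hv
  refine ⟨h.clean, ?_, ?_, h.tight, ?_⟩
  · intro k hk
    by_cases hkg : k = g
    · subst hkg; exact free.1
    · exact h.high_eq_none k (by simpa [hkg] using hk)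
  · intro k j hj
    by_cases hkg : k = g
    · subst hkg
      have : i ≠ j := by rintro rfl; exact hi hj
      simpa using this
    · simpa [hkg] using h.low_ne k j hj
  · intro Y
    simp only [sizes_update free.2]
    refine (h.canMatch Y).provisional (U := s.inPlay) (by omega)
      (fun y j hy => hy.of_add_single hr (valRank_none hc)) hi
      (fun y hy hle j hj => h.eq_of_notMem hy hle hj) ?_ ?_ ((running_iff s).1 running)
    · intro j hj
      have h4 : phiMNW M (utility v s.union) j c < phiMNW M (utility v s.union) i 1 := by
        have := (State.le_gain hj).trans_lt gain
        rw [chosen.gain_eq] at this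
        exact WithBot.coe_lt_coe.1 this
      refine lt_of_phiMNW_lt hM (by omega : 1 ≤ c) (hu i) ?_ h4
      rw [hu, h.sizes_low_eq_zero hj, add_zero]
    · intro j hj
      have h4 := chosen.1.2 j (Finset.mem_compl.2 hj)
      have := le_of_phiMNW_le (d := 1) (e := 1) (x := c * sizes s.high i + sizes s.low i) hM
        le_rfl le_rfl (by rw [hu, one_mul]) (hu j) (by simpa using h4)
      simpa using this

/-- Replacing a good `t` of `j` with a free good `g` does not change the sizes. -/
lemma sizes_update_update {X : Allocation n G} {t g : G} {j : Fin n} (ht : X t = some j)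
    (hg : X g = none) :
    sizes (Function.update (Function.update X t none) g (some j)) = sizes X := by
  have htg : g ≠ t := by rintro rfl; simp [hg] at ht
  rw [sizes_update (by rw [Function.update_of_ne htg, hg])]
  funext k
  by_cases hk : k = j
  · subst hk
    have := Finset.card_erase_add_one (mem_bundle.2 ht)
    simpa [sizes, bundle_update_of_ne] using this
  · have h1 : X t ≠ some k := by simpa [ht] using Ne.symm hk
    simp [sizes, hk, bundle_update_of_ne_of_ne, h1]

/-- A step preserves the invariant, and either it removes an agent from `U` or it increases the
number of allocated goods by one. -/
lemma step (hc : 2 ≤ c) (hv : ∀ i, IsBivaluedSubmodular 1 (c : ℝ) (v i)) {M : ℝ}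
    (hM : 3 ≤ M) (h : Invariant c v s) {s' : State n G}
    (hs : Step (c : ℝ) v (phiMNW M) s s') :
    Invariant c v s' ∧
      ∑ i, sizes s'.high i + ∑ i, sizes s'.low i + s.inPlay.card =
        ∑ i, sizes s.high i + ∑ i, sizes s.low i + s'.inPlay.card + 1 := by
  have hr := isRank_valRank hc hv
  cases hs with
  | transfer i p t running gain chosen path last not_low =>
    refine ⟨h.transfer hc hv hM running gain chosen path last rfl (fun g hg => ?_) h.low_ne, ?_⟩
    · refine ⟨h.high_eq_none g hg, ?_⟩
      rintro rfl
      exact hg not_low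
    · simp only [h.sizes_augment hr path, sum_add_single]
      omega
  | steal i p t j g running gain chosen path last low free =>
    have hsz := sizes_update_update low free.2
    refine ⟨h.transfer hc hv hM running gain chosen path last hsz (fun k hk => ?_) ?_, ?_⟩
    · by_cases hkg : k = g
      · subst hkg
        refine ⟨free.1, ?_⟩
        rintro rfl
        simp [free.2] at low
      · rw [Function.update_of_ne hkg] at hk
        by_cases hkt : k = t
        · subst hkt; simp at hk
        · rw [Function.update_of_ne hkt] at hk
          exact ⟨h.high_eq_none k hk, hkt⟩
    · intro k a ha
      have hja : j ≠ a := by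
        rintro rfl
        exact h.low_ne t j ha low
      by_cases hkg : k = g
      · subst hkg; simpa using hja
      · by_cases hkt : k = t
        · subst hkt; simp [hkg]
        · simpa [hkg, hkt] using h.low_ne k a ha
    · simp only [h.sizes_augment hr path, sum_add_single, hsz]
      omega
  | leave i running gain chosen no_path =>
    refine ⟨h.leave hr no_path, ?_⟩
    have := Finset.card_erase_add_one chosen.1.1
    simp only
    omega
  | provisional i g running gain chosen free =>
    refine ⟨h.provisional hc hv hM running gain chosen free, ?_⟩
    simp only [sizes_update free.2, sum_add_single]
    omega

/-- While the loop condition holds, some step is possible. -/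
lemma _root_.YankeeSwap.State.Running.exists_step [NeZero n] {M : ℝ} (hs : s.Running) :
    ∃ s', Step (c : ℝ) v (phiMNW M) s s' := by
  obtain ⟨g, hg⟩ := exists_isFree hs
  by_cases gain : s.gain v (phiMNW M) s.inPlayᶜ 1 ≤ s.gain v (phiMNW M) s.inPlay c
  · have hne : s.inPlay.Nonempty := by
      rw [Finset.nonempty_iff_ne_empty]
      intro hemp
      rw [hemp, Finset.compl_empty] at gain
      have h1 := (State.le_gain (Finset.mem_univ (0 : Fin n))).trans gain
      rw [State.gain, Finset.sup_empty, le_bot_iff] at h1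
      exact WithBot.coe_ne_bot h1
    obtain ⟨i, chosen⟩ := State.exists_chooses (s := s) (v := v) (φ := phiMNW M) (α := c) hne
    by_cases hp : ∃ p, IsTransferPath (c : ℝ) v s.high i p
    · obtain ⟨p, path⟩ := exists_shortest_isPath hp
      obtain ⟨t, last, -⟩ := path.1.2.2
      cases hlow : s.low t with
      | none => exact ⟨_, .transfer s i p t hs gain chosen path last hlow⟩
      | some j => exact ⟨_, .steal s i p t j g hs gain chosen path last hlow hg⟩
    · exact ⟨_, .leave s i hs gain chosen hp⟩
  · have hne : s.inPlayᶜ.Nonempty := by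
      rw [Finset.nonempty_iff_ne_empty]
      intro hemp
      rw [hemp] at gain
      exact gain (by rw [State.gain, Finset.sup_empty]; exact bot_le)
    obtain ⟨i, chosen⟩ := State.exists_chooses (s := s) (v := v) (φ := phiMNW M) (α := 1) hne
    exact ⟨_, .provisional s i g hs (not_le.1 gain) chosen hg⟩

lemma isMaxNashWelfare (hc : 2 ≤ c) (hv : ∀ i, IsBivaluedSubmodular 1 (c : ℝ) (v i))
    (h : Invariant c v s) (hs : ¬ s.Running) : IsMaxNashWelfare v s.union := by
  have hr := isRank_valRank hc hv
  intro Y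
  rw [running_iff, not_lt] at hs
  have h1 := (h.canMatch Y).nashLE (le_antisymm h.sum_add_sum_le hs)
  rw [funext (utility_eq hc hv _), funext (utility_eq hc hv _)]
  refine NashLE.nashGE ?_
  convert h1 using 2 with i
  exact h.natUtility_union hr i

end Invariant

lemma Reaches.invariant (hc : 2 ≤ c) (hv : ∀ i, IsBivaluedSubmodular 1 (c : ℝ) (v i)) {M : ℝ}
    (hM : 3 ≤ M) {k : ℕ} {s : State n G} (h : Reaches (c : ℝ) v (phiMNW M) k s) :
    Invariant c v s ∧
      k + s.inPlay.card = n + (∑ i, sizes s.high i + ∑ i, sizes s.low i) := by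
  induction h with
  | init =>
    refine ⟨Invariant.init hc (isRank_valRank hc hv), ?_⟩
    simp [State.init, sizes, bundle]
  | step _ hs ih =>
    obtain ⟨h1, h2⟩ := ih.1.step hc hv hM hs
    refine ⟨h1, ?_⟩
    have := ih.2
    omega

end Algorithm

end YankeeSwap

theorem mainTheorem2 (c : ℕ) (hc : 2 ≤ c) :
    ∃ M₀ : ℝ, ∀ M : ℝ, M₀ ≤ M →
      ∀ (n m : ℕ), 1 ≤ n →
      ∀ v : Fin n → Finset (Fin m) → ℝ,
        (∀ i, YankeeSwap.IsBivaluedSubmodular 1 (c : ℝ) (v i)) →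
        ∀ (k : ℕ) (s : YankeeSwap.State n (Fin m)),
          YankeeSwap.Reaches (c : ℝ) v (YankeeSwap.phiMNW M) k s →
            k ≤ n + m ∧
            (s.Running → ∃ s', YankeeSwap.Step (c : ℝ) v (YankeeSwap.phiMNW M) s s') ∧
            (¬ s.Running → YankeeSwap.IsMaxNashWelfare v s.union) := by
  -- An agent with positive utility has gain at most `2`: its utility is at least `c` if it is in
  -- play. So for `M ≥ 3` agents with utility zero come first.
  refine ⟨3, fun M hM n m hn v hv k s hs => ?_⟩
  have : NeZero n := ⟨by omega⟩
  obtain ⟨hinv, hk⟩ := hs.invariant hc hv hM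
  refine ⟨?_, fun hrun => hrun.exists_step, fun hrun => hinv.isMaxNashWelfare hc hv hrun⟩
  have := hinv.sum_add_sum_le
  rw [Fintype.card_fin] at this
  omega
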